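/- Let $\mathbb T=\mathbb R/2\pi\mathbb Z$ carry the normalized measure $dx/2\pi$, with which all norms $\|\cdot\|_p$, Fourier coefficients $\widehat g(k)=\frac1{2\pi}\int_{\mathbb T}g(t)e^{-ikt}\,dt$ and convolutions on $\mathbb T$ are taken. Functions on $\mathbb T$ may be complex valued. Distributions on $\mathbb T$ are identified with their formal Fourier series, and the $L^p$-norm of a distribution is $+\infty$ if it is not a function in $L^p(\mathbb T)$. Let $\lambda,\beta:\mathbb R\to\mathbb R\setminus\{0\}$ be bounded $C^2$ functions, and let $\vartheta:\mathbb R\to\mathbb R$ be a $C^2$ function with $\vartheta=1$ on $[-\frac12,\frac12]$ and $\vartheta=0$ outside $(-1,1)$. A $C^2$ function $\psi:\mathbb R\to\mathbb R$ is of monotone type if there are constants $c_0>0$ and $R>0$ such that $|\psi(x)|\ge c_0|\psi(y)|$ and $|\psi''(x)|\ge c_0|\psi''(y)|$ for all real $x,y$ with $|x|,|y|\ge R$ and $|y|/2\le|x|\le 2|y|$. For $\psi\in\{\lambda,\beta\}$ put $\varphi_\psi=\sum_{k\in\mathbb Z}\psi(k)e^{ik\cdot}$. For $1\le p\le\infty$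 let $\mathcal H_{\lambda,p}(\mathbb T)$ be the space of all $f=\varphi_\lambda*g$ with $g\in L^p(\mathbb T)$, that is, $\widehat f(k)=\lambda(k)\widehat g(k)$ for all $k$, with norm $\|f\|_{\mathcal H_{\lambda,p}}=\|g\|_p$. Put $\mathcal G=\lambda/\beta$, $H_m(x)=\sum_{k\in\mathbb Z}\vartheta(k/m)\,\mathcal G(k)\,e^{ikx}$ and $V_m(g)=H_m*g$. For $f=\varphi_\lambda*g$ define $$Q_{m,\beta}(f)=\frac1{2m+1}\sum_{l=0}^{2m}V_m(g)\Big(\frac{2\pi l}{2m+1}\Big)\,\varphi_\beta\Big(\cdot-\frac{2\pi l}{2m+1}\Big).$$ Let $$J_m(\psi)=\int_{|x|\ge m}\Big(\Big|\frac{\psi(x)}m\Big|+|x\,\psi''(x)|\Big)dx\in[0,\infty],$$ $$\varepsilon_m=J_m(\lambda)+\sup_{|x|\le m}\Big(|\mathcal G(x)|+m^2\sup_{|y|\le m}|\mathcal G''(y)|\Big)J_m(\beta)\in[0,\infty],$$ with the convention $\infty\cdot0=0$. **Theorem.** Let $1\le p\le\infty$ and assume that $\lambda,\beta$ are of monotone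 type. Then there is a constant $c>0$ such that for all $f\in\mathcal H_{\lambda,p}(\mathbb T)$ and all integers $m\ge1$, $$\|f-Q_{m,\beta}(f)\|_p\le c\,\varepsilon_m\,\|f\|_{\mathcal H_{\lambda,p}(\mathbb T)}.$$ -/

import Mathlib

open MeasureTheory
open scoped ENNReal

noncomputable section

namespace TranslateApprox

instance twoPiPos : Fact (0 < 2 * Real.pi) := ⟨Real.two_pi_pos⟩

/-- The one-dimensional torus `ℝ / 2πℤ`. -/
abbrev Torus : Type := AddCircle (2 * Real.pi)

/-- The normalized measure `dx / (2π)` on the torus. -/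
abbrev torusMeasure : Measure Torus := AddCircle.haarAddCircle

/-- A formal Fourier series `∑ a k e^{ikx}`, identified with its family of coefficients.
Distributions on the torus are identified with such series, and an integrable function `h` with
`fourierCoeff h`. -/
abbrev FormalSeries : Type := ℤ → ℂ

/-- The series `φ_ψ = ∑ ψ(k) e^{ikx}`. -/
def phi (ψ : ℝ → ℝ) : FormalSeries := fun k => ((ψ (k : ℝ) : ℝ) : ℂ)

/-- Convolution of formal series. It extends the convolution
`(u * v)(x) = (1/2π) ∫ u(x - t) v(t) dt` of integrable functions. -/
def conv (a b : FormalSeries) : FormalSeries := fun k => a k * b k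

/-- The translate `a(· - y)` of a formal series: the `k`-th coefficient is multiplied
by `e^{-iky}`. -/
def translate (y : ℝ) (a : FormalSeries) : FormalSeries :=
  fun k => fourier (-k) (y : Torus) * a k

/-- The `L^p` norm (normalized measure) of a formal series: `‖h‖_p` if the series is the Fourier
series of a function `h` in `L^p`, and `∞` if there is no such function. -/
def seriesNorm (p : ℝ≥0∞) (a : FormalSeries) : ℝ≥0∞ :=
  ⨅ (h : Torus → ℂ) (_ : MemLp h p torusMeasure ∧ ∀ k, fourierCoeff h k = a k),
    eLpNorm h p torusMeasure

/-- `f = φ_lam * g` with `g ∈ L^p`, that is, `f` belongs to the space `H_{lam,p}`. The function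
`g` is determined by `f` when `lam` has no zeros, and the norm of `f` in `H_{lam,p}`
is `‖g‖_p`. -/
def Represents (lam : ℝ → ℝ) (p : ℝ≥0∞) (f : FormalSeries) (g : Torus → ℂ) : Prop :=
  MemLp g p torusMeasure ∧ f = conv (phi lam) (fourierCoeff g)

/-- A `C²` cut-off function: `1` on `[-1/2, 1/2]` and `0` outside `(-1, 1)`. -/
structure IsCutoff (θ : ℝ → ℝ) : Prop where
  contDiff : ContDiff ℝ 2 θ
  eq_one : ∀ x ∈ Set.Icc (-(1 / 2) : ℝ) (1 / 2), θ x = 1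
  eq_zero : ∀ x ∉ Set.Ioo (-1 : ℝ) 1, θ x = 0

/-- Functions of monotone type. The comparison is required for arguments of large modulus only:
a `C²` function satisfying it on the whole line cannot be nonzero and integrable. -/
structure IsMonotoneType (ψ : ℝ → ℝ) : Prop where
  contDiff : ContDiff ℝ 2 ψ
  comparable : ∃ c₀ > (0 : ℝ), ∃ R > (0 : ℝ), ∀ x y : ℝ, R ≤ |x| → R ≤ |y| →
    |x| ≤ 2 * |y| → |y| / 2 ≤ |x| →
      c₀ * |ψ y| ≤ |ψ x| ∧ c₀ * |iteratedDeriv 2 ψ y| ≤ |iteratedDeriv 2 ψ x|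

/-- The quotient `G = lam / β`. -/
def quot (lam β : ℝ → ℝ) : ℝ → ℝ := fun x => lam x / β x

/-- The trigonometric polynomial `H_m(x) = ∑ θ(k/m) G(k) e^{ikx}`. The terms with `|k| > m`
vanish because `θ` is zero outside `(-1, 1)`. -/
def kernelH (θ lam β : ℝ → ℝ) (m : ℕ) (x : Torus) : ℂ :=
  ∑ k ∈ Finset.Icc (-(m : ℤ)) (m : ℤ),
    ((θ ((k : ℝ) / (m : ℝ)) * quot lam β (k : ℝ) : ℝ) : ℂ) * fourier k x

/-- `V_m(g) = H_m * g`. -/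
def opV (θ lam β : ℝ → ℝ) (m : ℕ) (g : Torus → ℂ) (x : Torus) : ℂ :=
  ∫ t, kernelH θ lam β m (x - t) * g t ∂torusMeasure

/-- The equispaced nodes `2πl / (2m+1)`. -/
def node (m l : ℕ) : ℝ := 2 * Real.pi * (l : ℝ) / (2 * (m : ℝ) + 1)

/-- `Q_{m,β}(f) = (2m+1)⁻¹ ∑_{l=0}^{2m} V_m(g)(y_l) φ_β(· - y_l)`, where `f = φ_lam * g` and
`y_l` are the equispaced nodes. -/
def opQ (θ lam β : ℝ → ℝ) (m : ℕ) (g : Torus → ℂ) : FormalSeries :=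
  (1 / (2 * (m : ℂ) + 1)) •
    ∑ l ∈ Finset.range (2 * m + 1),
      opV θ lam β m g (node m l : Torus) • translate (node m l) (phi β)

/-- `J_m(ψ) = ∫_{|x| ≥ m} (|ψ(x)/m| + |x ψ''(x)|) dx`, possibly infinite. -/
def tailJ (m : ℕ) (ψ : ℝ → ℝ) : ℝ≥0∞ :=
  ∫⁻ x in {x : ℝ | (m : ℝ) ≤ |x|}, (‖ψ x / (m : ℝ)‖ₑ + ‖x * iteratedDeriv 2 ψ x‖ₑ)

/-- `ε_m = J_m(lam) + sup_{|x| ≤ m} (|G(x)| + m² sup_{|y| ≤ m} |G''(y)|) J_m(β)`. -/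
def epsilon (lam β : ℝ → ℝ) (m : ℕ) : ℝ≥0∞ :=
  tailJ m lam +
    (⨆ x ∈ Set.Icc (-(m : ℝ)) (m : ℝ),
      (‖quot lam β x‖ₑ + (m : ℝ≥0∞) ^ 2 *
        ⨆ y ∈ Set.Icc (-(m : ℝ)) (m : ℝ), ‖iteratedDeriv 2 (quot lam β) y‖ₑ)) * tailJ m β

end TranslateApprox

end

namespace TranslateApprox

/-! Sampling at `2m+1` equispaced nodes cannot distinguish frequencies congruent modulo `n = 2m+1`.
Hence the `k`-th coefficient of `Q_{m,β}(f)` is `β(k)` times the sum of the coefficients of `V_m(g)`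
over the class of `k` mod `n`. Writing `k' = k - nj`, the error becomes a sum over `j ∈ ℤ` of
Fourier multipliers `b_j(k')` applied to `g` and then modulated by `e^{injx}` (`sub_opQ_eq_tsum`).
Since `β G = lam`, the multiplier is `(1 - θ(k/m)) lam(k)` for `j = 0`; it is `-θ(k/m) G(k) β(k +
nj)` for `j ≠ 0`.

Modulation preserves `L^p` norms, so by Minkowski and Young it suffices to sum the `L¹` norms of the
kernels (`seriesNorm_le_tsum_coeffNorm`); this treats all `1 ≤ p ≤ ∞` alike. A kernel is bounded by
the `ℓ¹` norm of its coefficients, and by that of their second differences times `x⁻²`. Balancing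
the two at scale `1/m` gives `‖c‖₁/m + m‖Δ²c‖₁` (`lintegral_enorm_synth_le`), which for samples of a
`C²` function `v` is controlled by `∫ (|v|/m + m|v''|)` (`coeffNorm_le_lintegral_energy`). A Landau
inequality keeps this energy stable under multiplication by functions varying at scale `m`
(`setLIntegral_energy_mul_le`).

For `j ≠ 0` the energy of `β` is taken over windows of radius `m` about `nj`. They are disjoint and
lie in `|x| ≥ m`, so together they cost at most `J_m(β)`. For `j = 0` the transition zone `m/2 ≤ |x|
≤ m` is moved into the tail by `x ↦ 2x`, which is where monotone type enters
(`exists_setLIntegral_shell_le`). -/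

/-! ### Young's inequality on the torus -/

/-- Hölder's inequality in the form of comparison of `L¹` and `L^q` norms for the finite or infinite
measure `k dμ`. -/
lemma rpow_lintegral_mul_le {α : Type*} [MeasurableSpace α] {μ : Measure α} {k g : α → ℝ≥0∞}
    (hk : Measurable k) (hg : AEMeasurable g μ) {q : ℝ} (hq : 1 ≤ q) :
    (∫⁻ t, k t * g t ∂μ) ^ q ≤ (∫⁻ t, k t ∂μ) ^ (q - 1) * ∫⁻ t, k t * g t ^ q ∂μ := by
  have hac : μ.withDensity k ≪ μ := withDensity_absolutelyContinuous μ k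
  have h := eLpNorm'_le_eLpNorm'_mul_rpow_measure_univ (μ := μ.withDensity k) (f := g)
    one_pos hq (hg.mono_ac hac).aestronglyMeasurable
  simp only [eLpNorm', enorm_eq_self, ENNReal.rpow_one, div_one] at h
  rw [lintegral_withDensity_eq_lintegral_mul₀ hk.aemeasurable hg,
    lintegral_withDensity_eq_lintegral_mul₀ hk.aemeasurable (hg.pow_const q),
    withDensity_apply _ MeasurableSet.univ, setLIntegral_univ] at h
  have hq0 : (0 : ℝ) < q := by linarith
  calc (∫⁻ t, k t * g t ∂μ) ^ q
      ≤ ((∫⁻ t, k t * g t ^ q ∂μ) ^ (1 / q) * (∫⁻ t, k t ∂μ) ^ (1 - 1 / q)) ^ q :=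
        ENNReal.rpow_le_rpow h hq0.le
    _ = _ := by
        rw [ENNReal.mul_rpow_of_nonneg _ _ hq0.le, ← ENNReal.rpow_mul, ← ENNReal.rpow_mul,
          one_div_mul_cancel hq0.ne', ENNReal.rpow_one, mul_comm]
        congr 2
        field_simp

/-- Young's inequality `‖k * g‖_p ≤ ‖k‖_1 ‖g‖_p` for a continuous kernel on the torus. -/
lemma eLpNorm_conv_le {p : ℝ≥0∞} (hp : 1 ≤ p) (k : C(Torus, ℂ)) {g : Torus → ℂ}
    (hg : AEStronglyMeasurable g torusMeasure) :
    eLpNorm (fun x => ∫ t, k (x - t) * g t ∂torusMeasure) p torusMeasure ≤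
      (∫⁻ t, ‖k t‖ₑ ∂torusMeasure) * eLpNorm g p torusMeasure := by
  set M := ∫⁻ t, ‖k t‖ₑ ∂torusMeasure with hM
  have hk : Measurable fun t => ‖k t‖ₑ := k.continuous.measurable.enorm
  have hMx : ∀ x, ∫⁻ t, ‖k (x - t)‖ₑ ∂torusMeasure = M := fun x =>
    lintegral_sub_left_eq_self (fun t => ‖k t‖ₑ) x
  have hbase : ∀ x, ‖∫ t, k (x - t) * g t ∂torusMeasure‖ₑ ≤
      ∫⁻ t, ‖k (x - t)‖ₑ * ‖g t‖ₑ ∂torusMeasure := fun x =>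
    (enorm_integral_le_lintegral_enorm _).trans_eq (by simp [enorm_mul])
  rcases eq_or_ne p ∞ with rfl | hp'
  · rw [eLpNorm_exponent_top, eLpNorm_exponent_top]
    refine essSup_le_of_ae_le _ (Filter.Eventually.of_forall fun x => (hbase x).trans ?_)
    have hkx : Measurable fun t => ‖k (x - t)‖ₑ := hk.comp (measurable_const.sub measurable_id)
    beta_reduce
    rw [← hMx x, ← lintegral_mul_const _ hkx]
    refine lintegral_mono_ae ?_
    filter_upwards [enorm_ae_le_eLpNormEssSup g torusMeasure] with t ht
    gcongr
  · have hp0 : p ≠ 0 := (one_pos.trans_le hp).ne'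
    set q := p.toReal
    have hq : 1 ≤ q := by
      simpa using ENNReal.toReal_mono hp' hp
    have hq0 : 0 < q := by linarith
    have hgm : AEMeasurable (fun t => ‖g t‖ₑ) torusMeasure := hg.enorm
    rw [eLpNorm_eq_lintegral_rpow_enorm_toReal hp0 hp', eLpNorm_eq_lintegral_rpow_enorm_toReal hp0 hp']
    -- The preceding weighted inequality is used with weight `k(x - ·)` of mass `M`; Tonelli and
    -- translation invariance in `x` then yield the last factor `M`.
    have key : ∫⁻ x, ‖∫ t, k (x - t) * g t ∂torusMeasure‖ₑ ^ q ∂torusMeasure ≤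
        M ^ q * ∫⁻ t, ‖g t‖ₑ ^ q ∂torusMeasure := by
      calc _ ≤ ∫⁻ x, M ^ (q - 1) *
              ∫⁻ t, ‖k (x - t)‖ₑ * ‖g t‖ₑ ^ q ∂torusMeasure ∂torusMeasure := by
            refine lintegral_mono fun x => ?_
            refine (ENNReal.rpow_le_rpow (hbase x) hq0.le).trans ?_
            rw [← hMx x]
            exact rpow_lintegral_mul_le (hk.comp (measurable_const.sub measurable_id)) hgm hq
        _ ≤ M ^ (q - 1) *
              ∫⁻ x, ∫⁻ t, ‖k (x - t)‖ₑ * ‖g t‖ₑ ^ q ∂torusMeasure ∂torusMeasure := by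
            rw [lintegral_const_mul']
            exact ENNReal.rpow_ne_top_of_nonneg (by linarith) (by
              rw [hM]
              exact (k.continuous.integrable_of_hasCompactSupport
                (HasCompactSupport.of_compactSpace _)).2.ne)
        _ = M ^ (q - 1) * (M * ∫⁻ t, ‖g t‖ₑ ^ q ∂torusMeasure) := by
            congr 1
            rw [lintegral_lintegral_swap]
            · rw [← lintegral_const_mul'' _ (hgm.pow_const q)]
              refine lintegral_congr fun t => ?_
              have hkt : Measurable fun x => ‖k (x - t)‖ₑ :=
                hk.comp (measurable_id.sub measurable_const)
              rw [lintegral_mul_const _ hkt]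
              congr 1
              exact lintegral_sub_right_eq_self (fun t => ‖k t‖ₑ) t
            · exact (hk.comp (measurable_fst.sub measurable_snd)).aemeasurable.mul
                (hgm.pow_const q).comp_snd
        _ = M ^ q * ∫⁻ t, ‖g t‖ₑ ^ q ∂torusMeasure := by
            rw [← mul_assoc]
            congr 1
            nth_rewrite 2 [← ENNReal.rpow_one M]
            rw [← ENNReal.rpow_add_of_nonneg _ _ (by linarith) zero_le_one]
            simp
    calc _ ≤ (M ^ q * ∫⁻ t, ‖g t‖ₑ ^ q ∂torusMeasure) ^ (1 / q) :=
          ENNReal.rpow_le_rpow key (by positivity)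
      _ = _ := by
          rw [ENNReal.mul_rpow_of_nonneg _ _ (by positivity), ← ENNReal.rpow_mul,
            mul_one_div_cancel hq0.ne', ENNReal.rpow_one]

/-! ### Absolutely convergent Fourier series and their multipliers -/

/-- The continuous function with absolutely convergent Fourier series `∑ c k e^{ikx}`. -/
noncomputable def synth (c : ℤ → ℂ) : C(Torus, ℂ) := ∑' k, c k • fourier k

lemma summable_smul_fourier {c : ℤ → ℂ} (hc : Summable fun k => ‖c k‖) :
    Summable fun k => c k • (fourier k : C(Torus, ℂ)) :=
  Summable.of_norm (by simpa [norm_smul, fourier_norm] using hc)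

lemma hasSum_synth_apply {c : ℤ → ℂ} (hc : Summable fun k => ‖c k‖) (x : Torus) :
    HasSum (fun k => c k * fourier k x) (synth c x) := by
  exact ContinuousMap.hasSum_apply (summable_smul_fourier hc).hasSum x

lemma norm_synth_le {c : ℤ → ℂ} (hc : Summable fun k => ‖c k‖) :
    ‖synth c‖ ≤ ∑' k, ‖c k‖ := by
  refine tsum_of_norm_bounded hc.hasSum fun k => ?_
  simp [norm_smul, fourier_norm]

lemma norm_synth_apply_le {c : ℤ → ℂ} (hc : Summable fun k => ‖c k‖) (x : Torus) :
    ‖synth c x‖ ≤ ∑' k, ‖c k‖ :=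
  ((synth c).norm_coe_le_norm x).trans (norm_synth_le hc)

lemma norm_fourier_apply (k : ℤ) (x : Torus) : ‖fourier k x‖ = 1 := by
  rw [fourier_apply, Circle.norm_coe]

lemma fourier_sub_apply (k : ℤ) (x t : Torus) :
    fourier k (x - t) = fourier k x * fourier (-k) t := by
  simp only [fourier_apply, ← Circle.coe_mul, ← AddCircle.toCircle_add]
  congr 2
  rw [smul_sub, neg_smul, sub_eq_add_neg]

lemma norm_fourierCoeff_le (g : Torus → ℂ) (k : ℤ) :
    ‖fourierCoeff g k‖ ≤ ∫ t, ‖g t‖ ∂torusMeasure := by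
  refine (norm_integral_le_integral_norm _).trans_eq ?_
  simp only [norm_smul, norm_fourier_apply, one_mul]

lemma integral_fourier_sub_mul (g : Torus → ℂ) (k : ℤ) (x : Torus) :
    ∫ t, fourier k (x - t) * g t ∂torusMeasure = fourierCoeff g k * fourier k x := by
  simp only [fourier_sub_apply, mul_assoc, fourierCoeff, smul_eq_mul]
  rw [integral_const_mul, mul_comm]

lemma integrable_fourier_sub_mul {g : Torus → ℂ} (hg : Integrable g torusMeasure) (k : ℤ)
    (x : Torus) : Integrable (fun t => fourier k (x - t) * g t) torusMeasure := by
  simp only [fourier_sub_apply, mul_assoc]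
  exact (hg.fourier_smul (n := -k)).const_mul _

lemma summable_norm_mul_fourierCoeff {c : ℤ → ℂ} (hc : Summable fun k => ‖c k‖) (g : Torus → ℂ) :
    Summable fun k => ‖c k * fourierCoeff g k‖ := by
  refine Summable.of_nonneg_of_le (fun _ => norm_nonneg _) (fun k => ?_)
    (hc.mul_right (∫ t, ‖g t‖ ∂torusMeasure))
  rw [norm_mul]
  exact mul_le_mul_of_nonneg_left (norm_fourierCoeff_le g k) (norm_nonneg _)

/-- Convolution with `synth c` multiplies the Fourier coefficients by `c`. -/
lemma integral_synth_sub_mul {c : ℤ → ℂ} (hc : Summable fun k => ‖c k‖) {g : Torus → ℂ}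
    (hg : Integrable g torusMeasure) (x : Torus) :
    ∫ t, synth c (x - t) * g t ∂torusMeasure =
      synth (fun k => c k * fourierCoeff g k) x := by
  have hint : ∀ k, Integrable (fun t => c k * (fourier k (x - t) * g t)) torusMeasure := fun k =>
    (integrable_fourier_sub_mul hg k x).const_mul _
  have h := hasSum_integral_of_summable_integral_norm hint (by
    simpa only [norm_mul, norm_fourier_apply, one_mul, integral_const_mul] using hc.mul_right _)
  simp only [integral_const_mul, integral_fourier_sub_mul] at h
  have h2 := hasSum_synth_apply (summable_norm_mul_fourierCoeff hc g) x
  simp only [← mul_assoc] at h h2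
  rw [h2.unique h]
  refine integral_congr_ae (Filter.Eventually.of_forall fun t => ?_)
  exact ((hasSum_synth_apply hc (x - t)).mul_right (g t)).tsum_eq.symm

/-- Convolving with the single exponential `fourier k` and evaluating at `0` leaves only the term `c
k`; the same integral is the Fourier coefficient after `t ↦ -t`. -/
lemma fourierCoeff_synth {c : ℤ → ℂ} (hc : Summable fun k => ‖c k‖) (k : ℤ) :
    fourierCoeff (synth c) k = c k := by
  have hint : Integrable (fourier k : Torus → ℂ) torusMeasure :=
    (fourier k).continuous.integrable_of_hasCompactSupport (HasCompactSupport.of_compactSpace _)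
  have h := integral_synth_sub_mul hc hint 0
  have h2 := hasSum_synth_apply (summable_norm_mul_fourierCoeff hc (fourier k)) 0
  rw [← h] at h2
  have h3 := h2.tsum_eq
  rw [tsum_eq_single k (by
    intro j hj
    rw [fourierCoeff_fourier, Pi.single_eq_of_ne hj]; simp)] at h3
  rw [fourierCoeff_fourier] at h3
  simp only [Pi.single_eq_same, mul_one, fourier_eval_zero, zero_sub] at h3
  rw [h3, fourierCoeff, ← integral_neg_eq_self]
  refine integral_congr_ae (Filter.Eventually.of_forall fun t => ?_)
  have : fourier (-k) (-t) = fourier k t := by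
    rw [fourier_apply, fourier_apply]; congr 2; simp
  simp only [this, smul_eq_mul]
  ring

/-! ### Kernel `L¹` norms from second differences -/

lemma summable_shift {c : ℤ → ℂ} (hc : Summable fun k => ‖c k‖) (s : ℤ) :
    Summable fun k => ‖c (k + s)‖ :=
  (Equiv.addRight s).summable_iff.2 hc

lemma synth_shift_apply {c : ℤ → ℂ} (hc : Summable fun k => ‖c k‖) (s : ℤ) (x : Torus) :
    synth (fun k => c (k + s)) x = fourier (-s) x * synth c x := by
  have h := (Equiv.addRight s).hasSum_iff.2 ((hasSum_synth_apply hc x).mul_left (fourier (-s) x))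
  refine (hasSum_synth_apply (summable_shift hc s) x).unique (h.congr_fun ?_)
  intro k
  simp only [Function.comp, Equiv.coe_addRight]
  rw [mul_left_comm, ← fourier_add]
  simp

lemma fourier_one_add_neg_one (x : ℝ) :
    (fourier 1 (x : Torus) + fourier (-1) (x : Torus) - 2 : ℂ) =
      ((-(2 * (1 - Real.cos x)) : ℝ) : ℂ) := by
  have h : ∀ n : ℤ, fourier n (x : Torus) = Complex.exp (n * x * Complex.I) := by
    intro n
    rw [fourier_coe_apply]
    congr 1
    have : (Real.pi : ℂ) ≠ 0 := by exact_mod_cast Real.pi_ne_zero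
    push_cast
    field_simp
  rw [h, h]
  push_cast
  rw [Complex.cos]
  ring_nf

/-- Taking second differences of the coefficients multiplies the function by `e^{ix} + e^{-ix} - 2 =
-2(1 - cos x)`, and `1 - cos x ≥ 2x²/π²` on `[-π, π]`. -/
lemma norm_synth_mul_sq_le {c : ℤ → ℂ} (hc : Summable fun k => ‖c k‖) {x : ℝ}
    (hx : |x| ≤ Real.pi) :
    ‖synth c (x : Torus)‖ * (4 / Real.pi ^ 2 * x ^ 2) ≤
      ∑' k, ‖c (k + 1) - 2 * c k + c (k - 1)‖ := by
  have h1 := summable_shift hc 1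
  have h2 := summable_shift hc (-1)
  have hd : Summable fun k => ‖c (k + 1) - 2 * c k + c (k - 1)‖ := by
    refine Summable.of_nonneg_of_le (fun _ => norm_nonneg _) (fun k => ?_)
      ((h1.add (hc.mul_left 2)).add h2)
    refine (norm_add_le _ _).trans (add_le_add ((norm_sub_le _ _).trans ?_) le_rfl)
    simp
  have hs := hasSum_synth_apply hd (x : Torus)
  have hs' := (((hasSum_synth_apply h1 (x : Torus)).sub
    ((hasSum_synth_apply hc (x : Torus)).mul_left 2)).add (hasSum_synth_apply h2 (x : Torus)))
  have he := hs.unique (hs'.congr_fun fun k => by simp only [← sub_eq_add_neg]; ring)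
  rw [synth_shift_apply hc, synth_shift_apply hc, neg_neg] at he
  have he' : synth (fun k => c (k + 1) - 2 * c k + c (k - 1)) (x : Torus) =
      ((-(2 * (1 - Real.cos x)) : ℝ) : ℂ) * synth c (x : Torus) := by
    rw [he, ← fourier_one_add_neg_one]; ring
  have hb := norm_synth_apply_le hd (x : Torus)
  rw [he', norm_mul, Complex.norm_real, Real.norm_eq_abs, abs_neg,
    abs_of_nonneg (by linarith [Real.cos_le_one x])] at hb
  refine le_trans ?_ hb
  rw [mul_comm]
  refine mul_le_mul_of_nonneg_right ?_ (norm_nonneg _)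
  have := Real.cos_le_one_sub_mul_cos_sq hx
  have e : 4 / Real.pi ^ 2 * x ^ 2 = 2 * (2 / Real.pi ^ 2 * x ^ 2) := by ring
  rw [e]
  linarith

lemma integral_mul_inv_one_add_sq {M : ℝ} (hM : 0 < M) :
    ∫ x : ℝ, M * (1 + (M * x) ^ 2)⁻¹ = Real.pi := by
  rw [integral_const_mul, Measure.integral_comp_mul_left (fun x : ℝ => (1 + x ^ 2)⁻¹),
    integral_univ_inv_one_add_sq, abs_of_pos (inv_pos.2 hM), smul_eq_mul,
    mul_inv_cancel_left₀ hM.ne']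

/-- The `L¹` norm of a trigonometric series is controlled by the `ℓ¹` norms of its coefficients
and of their second differences. -/
lemma lintegral_enorm_synth_le {c : ℤ → ℂ} (hc : Summable fun k => ‖c k‖) {M : ℝ} (hM : 0 < M) :
    ∫⁻ t, ‖synth c t‖ₑ ∂torusMeasure ≤ ENNReal.ofReal (2 * ((∑' k, ‖c k‖) / M +
      M * ∑' k, ‖c (k + 1) - 2 * c k + c (k - 1)‖)) := by
  set S := ∑' k, ‖c k‖ with hS
  set D := ∑' k, ‖c (k + 1) - 2 * c k + c (k - 1)‖ with hD
  set N := S / M + M * D with hN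
  have hS0 : 0 ≤ S := tsum_nonneg fun _ => norm_nonneg _
  have hD0 : 0 ≤ D := tsum_nonneg fun _ => norm_nonneg _
  have hN0 : 0 ≤ N := by positivity
  -- The bounds `A ≤ S` and `A x² ≤ 3D` (as `π²/4 ≤ 3`) add up to `A(1 + M²x²) ≤ S + 3M²D ≤ 4MN`.
  -- The dominating profile `M/(1 + (Mx)²)` has integral `π` whatever `M` is.
  have hpt : ∀ x ∈ Set.Ioc (-Real.pi) (-Real.pi + 2 * Real.pi),
      ‖synth c (x : Torus)‖ₑ ≤ ENNReal.ofReal (4 * N * (M * (1 + (M * x) ^ 2)⁻¹)) := by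
    intro x hx
    have hx' : |x| ≤ Real.pi := abs_le.2 ⟨hx.1.le, by linarith [hx.2]⟩
    rw [← ofReal_norm]
    refine ENNReal.ofReal_le_ofReal ?_
    set A := ‖synth c (x : Torus)‖
    have h0 : A ≤ S := norm_synth_apply_le hc _
    have h2 : A * (4 / Real.pi ^ 2 * x ^ 2) ≤ D := norm_synth_mul_sq_le hc hx'
    have hA : 0 ≤ A := norm_nonneg _
    have h3 : A * x ^ 2 ≤ 3 * D := by
      have hpi : Real.pi ^ 2 / 4 ≤ 3 := by nlinarith [Real.pi_lt_d2, Real.pi_pos]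
      calc A * x ^ 2 = A * (4 / Real.pi ^ 2 * x ^ 2) * (Real.pi ^ 2 / 4) := by
            field_simp
        _ ≤ D * 3 := by gcongr
        _ = _ := by ring
    rw [← mul_assoc, ← div_eq_mul_inv, le_div_iff₀ (by positivity)]
    have h4 : M * N = S + M ^ 2 * D := by rw [hN]; field_simp
    nlinarith [mul_le_mul_of_nonneg_left h3 (sq_nonneg M), mul_nonneg (sq_nonneg M) hD0]
  have hint : Integrable fun x : ℝ => 4 * N * (M * (1 + (M * x) ^ 2)⁻¹) :=
    ((integrable_inv_one_add_sq.comp_mul_left' hM.ne').const_mul M).const_mul _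
  have hvol : ∫⁻ t : Torus, ‖synth c t‖ₑ ≤ ENNReal.ofReal (4 * N * Real.pi) := by
    rw [← AddCircle.lintegral_preimage (2 * Real.pi) (-Real.pi)]
    calc _ ≤ ∫⁻ x in Set.Ioc (-Real.pi) (-Real.pi + 2 * Real.pi),
            ENNReal.ofReal (4 * N * (M * (1 + (M * x) ^ 2)⁻¹)) :=
          setLIntegral_mono' measurableSet_Ioc hpt
      _ ≤ ∫⁻ x, ENNReal.ofReal (4 * N * (M * (1 + (M * x) ^ 2)⁻¹)) := setLIntegral_le_lintegral _ _
      _ = _ := by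
        rw [← ofReal_integral_eq_lintegral_ofReal hint
          (Filter.Eventually.of_forall fun x => by positivity), integral_const_mul,
          integral_mul_inv_one_add_sq hM]
  -- Passing to the normalized measure divides by `2π` and turns `4Nπ` into `2N`.
  rw [AddCircle.volume_eq_smul_haarAddCircle, lintegral_smul_measure, smul_eq_mul,
    show 4 * N * Real.pi = 2 * Real.pi * (2 * N) by ring,
    ENNReal.ofReal_mul Real.two_pi_pos.le] at hvol
  exact (ENNReal.mul_le_mul_iff_right (ENNReal.ofReal_pos.2 Real.two_pi_pos).ne'
    ENNReal.ofReal_ne_top).1 hvol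

/-- The quantity `‖c‖_{ℓ¹} / m + m ‖Δ²c‖_{ℓ¹}` of a sequence of coefficients. -/
noncomputable def coeffNorm (m : ℕ) (c : ℤ → ℂ) : ℝ≥0∞ :=
  (∑' k, ‖c k‖ₑ) / m + m * ∑' k, ‖c (k + 1) - 2 * c k + c (k - 1)‖ₑ

lemma summable_second_difference {c : ℤ → ℂ} (hc : Summable fun k => ‖c k‖) :
    Summable fun k => ‖c (k + 1) - 2 * c k + c (k - 1)‖ := by
  refine Summable.of_nonneg_of_le (fun _ => norm_nonneg _) (fun k => ?_)
    (((summable_shift hc 1).add (hc.mul_left 2)).add (summable_shift hc (-1)))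
  refine (norm_add_le _ _).trans (add_le_add ((norm_sub_le _ _).trans ?_) le_rfl)
  simp

lemma ofReal_tsum_norm {c : ℤ → ℂ} (hc : Summable fun k => ‖c k‖) :
    ENNReal.ofReal (∑' k, ‖c k‖) = ∑' k, ‖c k‖ₑ := by
  rw [ENNReal.ofReal_tsum_of_nonneg (fun _ => norm_nonneg _) hc]
  simp

lemma lintegral_enorm_synth_le_coeffNorm {m : ℕ} (hm : 1 ≤ m) {c : ℤ → ℂ}
    (hc : Summable fun k => ‖c k‖) :
    ∫⁻ t, ‖synth c t‖ₑ ∂torusMeasure ≤ 2 * coeffNorm m c := by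
  have hm0 : (0 : ℝ) < m := by exact_mod_cast hm
  refine (lintegral_enorm_synth_le hc hm0).trans_eq ?_
  rw [ENNReal.ofReal_mul zero_le_two, ENNReal.ofReal_add (by positivity) (by positivity),
    ENNReal.ofReal_div_of_pos hm0, ENNReal.ofReal_mul hm0.le, ofReal_tsum_norm hc,
    ofReal_tsum_norm (summable_second_difference hc)]
  simp [coeffNorm]

lemma eLpNorm_synth_mul_fourierCoeff_le {p : ℝ≥0∞} (hp : 1 ≤ p) {m : ℕ} (hm : 1 ≤ m) {c : ℤ → ℂ}
    (hc : Summable fun k => ‖c k‖) {g : Torus → ℂ} (hg : MemLp g p torusMeasure) :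
    eLpNorm (synth fun k => c k * fourierCoeff g k) p torusMeasure ≤
      2 * coeffNorm m c * eLpNorm g p torusMeasure := by
  refine le_trans ?_ (mul_le_mul_left (lintegral_enorm_synth_le_coeffNorm hm hc) _)
  refine le_trans (le_of_eq ?_) (eLpNorm_conv_le hp (synth c) hg.1)
  congr 1
  ext x
  rw [integral_synth_sub_mul hc (hg.integrable hp)]

/-! ### Superpositions of modulated multipliers -/

lemma eLpNorm_synth_shift {p : ℝ≥0∞} {c : ℤ → ℂ} (hc : Summable fun k => ‖c k‖) (s : ℤ) :
    eLpNorm (synth fun k => c (k + s)) p torusMeasure = eLpNorm (synth c) p torusMeasure := by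
  refine eLpNorm_congr_norm_ae (Filter.Eventually.of_forall fun x => ?_)
  rw [synth_shift_apply hc, norm_mul, norm_fourier_apply, one_mul]

/-- Minkowski's inequality for series, transported through the continuous embedding of `C(Torus, ℂ)`
into `L^p`; uniform summability only serves to make the series converge. -/
lemma eLpNorm_tsum_le {ι : Type*} {p : ℝ≥0∞} (hp : 1 ≤ p) {W : ι → C(Torus, ℂ)}
    (hW : Summable fun j => ‖W j‖) :
    eLpNorm (∑' j, W j : C(Torus, ℂ)) p torusMeasure ≤ ∑' j, eLpNorm (W j) p torusMeasure := by
  have : Fact (1 ≤ p) := ⟨hp⟩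
  have he : ∀ f : C(Torus, ℂ), ‖ContinuousMap.toLp (E := ℂ) p torusMeasure ℂ f‖ₑ =
      eLpNorm f p torusMeasure := fun f => by
    rw [Lp.enorm_def]
    exact eLpNorm_congr_ae (ContinuousMap.coeFn_toLp torusMeasure f)
  have h := (ContinuousMap.toLp (E := ℂ) p torusMeasure ℂ).hasSum hW.of_norm.hasSum
  simp only [← he]
  rw [← h.tsum_eq]
  exact enorm_tsum_le_tsum_enorm

lemma fourierCoeff_tsum {ι : Type*} [Countable ι] {W : ι → C(Torus, ℂ)}
    (hW : Summable fun j => ‖W j‖) (k : ℤ) :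
    fourierCoeff (∑' j, W j : C(Torus, ℂ)) k = ∑' j, fourierCoeff (W j) k := by
  have hint : ∀ j, Integrable (fun t => fourier (-k) t • W j t) torusMeasure := fun j =>
    ((W j).continuous.integrable_of_hasCompactSupport
      (HasCompactSupport.of_compactSpace _)).fourier_smul (-k)
  have h := hasSum_integral_of_summable_integral_norm hint (by
    refine Summable.of_nonneg_of_le (fun j => integral_nonneg fun _ => norm_nonneg _)
      (fun j => ?_) hW
    have := integral_mono_of_nonneg (μ := torusMeasure)
      (Filter.Eventually.of_forall fun t => norm_nonneg (fourier (-k) t • W j t))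
      (integrable_const ‖W j‖) (Filter.Eventually.of_forall fun t => by
        simpa only [norm_smul, norm_fourier_apply, one_mul] using (W j).norm_coe_le_norm t)
    simpa using this)
  simp only [fourierCoeff]
  rw [h.tsum_eq]
  refine integral_congr_ae (Filter.Eventually.of_forall fun t => ?_)
  have := ContinuousMap.hasSum_apply hW.of_norm.hasSum t
  exact ((this.mul_left (fourier (-k) t)).tsum_eq).symm

/-- A superposition of modulated Fourier multipliers applied to `g`. -/
lemma seriesNorm_le_tsum_coeffNorm {p : ℝ≥0∞} (hp : 1 ≤ p) {m : ℕ} (hm : 1 ≤ m)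
    {b : ℤ → ℤ → ℂ} (s : ℤ → ℤ) (hb : ∑' j, coeffNorm m (b j) ≠ ∞) {g : Torus → ℂ}
    (hg : MemLp g p torusMeasure) {e : FormalSeries}
    (he : ∀ k, e k = ∑' j, b j (k + s j) * fourierCoeff g (k + s j)) :
    seriesNorm p e ≤ 2 * (∑' j, coeffNorm m (b j)) * eLpNorm g p torusMeasure := by
  have hm0 : (m : ℝ≥0∞) ≠ 0 := by exact_mod_cast (by omega : m ≠ 0)
  -- The first half of `coeffNorm` is the `ℓ¹` norm over `m`, so finiteness of the total makes the
  -- double series absolutely convergent.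
  have hsum : ∑' j, ∑' k, ‖b j k‖ₑ ≠ ∞ := by
    have hle : (∑' j, ∑' k, ‖b j k‖ₑ) / m ≤ ∑' j, coeffNorm m (b j) := by
      rw [div_eq_mul_inv, ← ENNReal.tsum_mul_right]
      exact ENNReal.tsum_le_tsum fun j => le_self_add
    intro h
    rw [h, ENNReal.top_div_of_ne_top (ENNReal.natCast_ne_top m)] at hle
    exact hb (top_le_iff.1 hle)
  have hbj : ∀ j, Summable fun k => ‖b j k‖ := fun j =>
    tsum_enorm_ne_top_iff_summable_norm.1 (ENNReal.ne_top_of_tsum_ne_top hsum j)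
  have hnorm : Summable fun j => ∑' k, ‖b j k‖ := by
    have := ENNReal.summable_toReal hsum
    refine this.congr fun j => ?_
    rw [← ofReal_tsum_norm (hbj j), ENNReal.toReal_ofReal (tsum_nonneg fun _ => norm_nonneg _)]
  set d : ℤ → ℤ → ℂ := fun j k => b j k * fourierCoeff g k
  have hd : ∀ j, Summable fun k => ‖d j k‖ := fun j => summable_norm_mul_fourierCoeff (hbj j) g
  set W : ℤ → C(Torus, ℂ) := fun j => synth fun k => d j (k + s j) with hWdef
  -- Uniform summability follows from `|ĝ| ≤ ‖g‖₁`, since a shift does not change an `ℓ¹` norm.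
  have hW : Summable fun j => ‖W j‖ := by
    refine Summable.of_nonneg_of_le (fun j => norm_nonneg _) (fun j => ?_)
      (hnorm.mul_right (∫ t, ‖g t‖ ∂torusMeasure))
    refine (norm_synth_le (summable_shift (hd j) (s j))).trans ?_
    refine ((Equiv.addRight (s j)).tsum_eq (fun k => ‖d j k‖)).trans_le ?_
    rw [← tsum_mul_right]
    refine (hd j).tsum_le_tsum (fun k => ?_) ((hbj j).mul_right _)
    rw [norm_mul]
    exact mul_le_mul_of_nonneg_left (norm_fourierCoeff_le g k) (norm_nonneg _)
  have hmem : MemLp (∑' j, W j : C(Torus, ℂ)) p torusMeasure :=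
    (∑' j, W j : C(Torus, ℂ)).continuous.memLp_of_hasCompactSupport
      (HasCompactSupport.of_compactSpace _)
  have hcoeff : ∀ k, fourierCoeff (∑' j, W j : C(Torus, ℂ)) k = e k := by
    intro k
    rw [fourierCoeff_tsum hW, he]
    exact tsum_congr fun j => fourierCoeff_synth (summable_shift (hd j) (s j)) k
  refine (iInf₂_le (⇑(∑' j, W j : C(Torus, ℂ))) ⟨hmem, hcoeff⟩).trans ?_
  refine (eLpNorm_tsum_le hp hW).trans ?_
  rw [← ENNReal.tsum_mul_left, ← ENNReal.tsum_mul_right]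
  refine ENNReal.tsum_le_tsum fun j => ?_
  simp only [hWdef]
  rw [eLpNorm_synth_shift (hd j)]
  exact eLpNorm_synth_mul_fourierCoeff_le hp hm (hbj j) hg

/-! ### Interpolation, products and sampling for `C²` functions -/

/-- `v₁` and `v₂` are the first two derivatives of the `C²` function `v`. -/
structure IsJet (v v₁ v₂ : ℝ → ℝ) : Prop where
  hasDerivAt : ∀ x, HasDerivAt v (v₁ x) x
  hasDerivAt' : ∀ x, HasDerivAt v₁ (v₂ x) x
  continuous₂ : Continuous v₂

namespace IsJet

variable {u u₁ u₂ v v₁ v₂ : ℝ → ℝ}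

lemma continuous (h : IsJet v v₁ v₂) : Continuous v :=
  continuous_iff_continuousAt.2 fun x => (h.hasDerivAt x).continuousAt

lemma continuous₁ (h : IsJet v v₁ v₂) : Continuous v₁ :=
  continuous_iff_continuousAt.2 fun x => (h.hasDerivAt' x).continuousAt

lemma of_contDiff (h : ContDiff ℝ 2 v) : IsJet v (deriv v) (iteratedDeriv 2 v) := by
  have h1 : ContDiff ℝ 1 (deriv v) := (contDiff_succ_iff_deriv.1 h).2.2
  refine ⟨fun x => (h.differentiable two_ne_zero x).hasDerivAt, fun x => ?_,
    h.continuous_iteratedDeriv 2 le_rfl⟩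
  rw [iteratedDeriv_succ, iteratedDeriv_one]
  exact (h1.differentiable one_ne_zero x).hasDerivAt

lemma mul (hu : IsJet u u₁ u₂) (hv : IsJet v v₁ v₂) :
    IsJet (fun x => u x * v x) (fun x => u₁ x * v x + u x * v₁ x)
      (fun x => u₂ x * v x + 2 * (u₁ x * v₁ x) + u x * v₂ x) := by
  refine ⟨fun x => (hu.hasDerivAt x).mul (hv.hasDerivAt x), fun x => ?_, ?_⟩
  · refine (((hu.hasDerivAt' x).mul (hv.hasDerivAt x)).add
      ((hu.hasDerivAt x).mul (hv.hasDerivAt' x))).congr_deriv ?_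
    ring
  · have := hu.continuous; have := hu.continuous₁; have := hu.continuous₂
    have := hv.continuous; have := hv.continuous₁; have := hv.continuous₂
    fun_prop

lemma comp_add_const (hv : IsJet v v₁ v₂) (s : ℝ) :
    IsJet (fun x => v (x + s)) (fun x => v₁ (x + s)) (fun x => v₂ (x + s)) :=
  ⟨fun x => (hv.hasDerivAt (x + s)).comp_add_const x s,
    fun x => (hv.hasDerivAt' (x + s)).comp_add_const x s,
    hv.continuous₂.comp (continuous_add_const s)⟩

lemma comp_div (hv : IsJet v v₁ v₂) (c : ℝ) :
    IsJet (fun x => v (x / c)) (fun x => v₁ (x / c) / c) (fun x => v₂ (x / c) / c ^ 2) := by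
  have hd : ∀ x, HasDerivAt (fun x : ℝ => x / c) (1 / c) x := fun x => (hasDerivAt_id x).div_const c
  refine ⟨fun x => ((hv.hasDerivAt (x / c)).comp x (hd x)).congr_deriv (by ring),
    fun x => (((hv.hasDerivAt' (x / c)).comp x (hd x)).div_const c).congr_deriv (by ring),
    (hv.continuous₂.comp (continuous_id.div_const c)).div_const _⟩

lemma one_sub (hv : IsJet v v₁ v₂) :
    IsJet (fun x => 1 - v x) (fun x => -v₁ x) (fun x => -v₂ x) :=
  ⟨fun x => (hv.hasDerivAt x).const_sub 1, fun x => (hv.hasDerivAt' x).neg, hv.continuous₂.neg⟩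

lemma neg (hv : IsJet v v₁ v₂) : IsJet (fun x => -v x) (fun x => -v₁ x) (fun x => -v₂ x) :=
  ⟨fun x => (hv.hasDerivAt x).neg, fun x => (hv.hasDerivAt' x).neg, hv.continuous₂.neg⟩

end IsJet

lemma enorm_sub_le_setLIntegral {v v₁ : ℝ → ℝ} (h : ∀ x, HasDerivAt v (v₁ x) x)
    (h₁ : Continuous v₁) {a b x y : ℝ} (hx : x ∈ Set.Icc a b) (hy : y ∈ Set.Icc a b) :
    ‖v x - v y‖ₑ ≤ ∫⁻ t in Set.Icc a b, ‖v₁ t‖ₑ := by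
  rw [← intervalIntegral.integral_eq_sub_of_hasDerivAt (fun t _ => h t) (h₁.intervalIntegrable _ _),
    ← ofReal_norm, intervalIntegral.norm_integral_eq_norm_integral_uIoc, ofReal_norm]
  refine (enorm_integral_le_lintegral_enorm _).trans (lintegral_mono_set ?_)
  exact Set.uIoc_subset_uIcc.trans (Set.uIcc_subset_Icc hy hx)

lemma exists_enorm_le_average {v : ℝ → ℝ} (hv : Continuous v) {a b : ℝ} (hab : a < b) :
    ∃ x ∈ Set.Icc a b, ‖v x‖ₑ ≤ (∫⁻ t in Set.Icc a b, ‖v t‖ₑ) / ENNReal.ofReal (b - a) := by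
  have h := exists_le_setLAverage (μ := volume) (s := Set.Icc a b) (f := fun t => ‖v t‖ₑ)
    (by simp [hab]) (by simp) hv.enorm.aemeasurable
  simpa [setLAverage_eq] using h

/-- An interpolation inequality of Landau type on an interval of length comparable to `m`. -/
lemma enorm_deriv_le {v v₁ v₂ : ℝ → ℝ} (h : IsJet v v₁ v₂) {m : ℕ} (hm : 1 ≤ m) {a b x : ℝ}
    (hab : (m : ℝ) / 2 ≤ b - a) (hx : x ∈ Set.Icc a b) :
    ‖v₁ x‖ₑ ≤ 72 * (∫⁻ t in Set.Icc a b, ‖v t‖ₑ) / m / m + ∫⁻ t in Set.Icc a b, ‖v₂ t‖ₑ := by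
  have hm0 : (1 : ℝ) ≤ m := by exact_mod_cast hm
  set I := ∫⁻ t in Set.Icc a b, ‖v t‖ₑ
  -- In each outer third some point has `|v|` at most its average, hence at most `I/(m/6)`. These
  -- points are at least `d ≥ m/6` apart, so the mean value theorem gives a `ξ` with `|v₁ ξ| ≤
  -- 2·36·I/m²`; moving from `ξ` to `x` costs `∫|v₂|`.
  set d := (b - a) / 3 with hd
  have hd0 : 0 < d := by rw [hd]; linarith
  have hdm : (m : ℝ≥0∞) / 6 ≤ ENNReal.ofReal d := by
    have e : ENNReal.ofReal ((m : ℝ) / 6) = (m : ℝ≥0∞) / 6 := by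
      rw [ENNReal.ofReal_div_of_pos (by norm_num)]; simp
    rw [← e]
    exact ENNReal.ofReal_le_ofReal (by rw [hd]; linarith)
  have avg : ∀ c, a ≤ c → c + d ≤ b → ∃ s ∈ Set.Icc c (c + d), ‖v s‖ₑ ≤ I / (m / 6) := by
    intro c hc hc'
    obtain ⟨s, hs, hle⟩ := exists_enorm_le_average h.continuous (lt_add_of_pos_right c hd0)
    refine ⟨s, hs, hle.trans ?_⟩
    rw [add_sub_cancel_left]
    exact ENNReal.div_le_div (lintegral_mono_set (Set.Icc_subset_Icc hc hc')) hdm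
  obtain ⟨s, hs, hvs⟩ := avg a le_rfl (by rw [hd]; linarith)
  obtain ⟨t, ht, hvt⟩ := avg (b - d) (by rw [hd]; linarith) (by linarith)
  have hst : d ≤ t - s := by
    have := hs.2; have := ht.1; have : 3 * d = b - a := by rw [hd]; ring
    linarith
  obtain ⟨ξ, hξ, hslope⟩ := exists_hasDerivAt_eq_slope v v₁ (by linarith : s < t)
    h.continuous.continuousOn (fun x _ => h.hasDerivAt x)
  have hξ' : ξ ∈ Set.Icc a b := ⟨hs.1.trans hξ.1.le, hξ.2.le.trans (by linarith [ht.2])⟩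
  have h1 : ‖v₁ ξ‖ₑ ≤ (I / (m / 6) + I / (m / 6)) / (m / 6) := by
    rw [hslope, div_eq_mul_inv, enorm_mul, enorm_inv (by linarith), ← div_eq_mul_inv]
    refine ENNReal.div_le_div (enorm_sub_le.trans (add_le_add hvt hvs)) (hdm.trans ?_)
    rw [Real.enorm_of_nonneg (by linarith)]
    exact ENNReal.ofReal_le_ofReal hst
  have h2 : (I / (m / 6) + I / (m / 6)) / (m / 6) = 72 * I / m / m := by
    have h6 : ((m : ℝ≥0∞) / 6)⁻¹ = 6 * (m : ℝ≥0∞)⁻¹ := by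
      rw [ENNReal.inv_div (by simp) (by simp), div_eq_mul_inv]
    simp only [div_eq_mul_inv] at h6 ⊢
    rw [h6]
    ring
  calc ‖v₁ x‖ₑ = ‖v₁ ξ + (v₁ x - v₁ ξ)‖ₑ := by ring_nf
    _ ≤ ‖v₁ ξ‖ₑ + ‖v₁ x - v₁ ξ‖ₑ := enorm_add_le _ _
    _ ≤ _ := add_le_add (h1.trans_eq h2)
      (enorm_sub_le_setLIntegral h.hasDerivAt' h.continuous₂ hx hξ')

/-- The density `|v| / m + m |v₂|`. -/
noncomputable def energy (m : ℕ) (v v₂ : ℝ → ℝ) (x : ℝ) : ℝ≥0∞ := ‖v x‖ₑ / m + m * ‖v₂ x‖ₑ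

lemma setLIntegral_energy {v v₂ : ℝ → ℝ} (hv : Continuous v) (m : ℕ) (s : Set ℝ) :
    ∫⁻ x in s, energy m v v₂ x = (∫⁻ x in s, ‖v x‖ₑ) / m + m * ∫⁻ x in s, ‖v₂ x‖ₑ := by
  unfold energy
  simp only [div_eq_mul_inv]
  rw [lintegral_add_left (hv.enorm.measurable.mul_const _), lintegral_mul_const _ hv.enorm.measurable,
    lintegral_const_mul' _ _ (ENNReal.natCast_ne_top m)]

/-- The pointwise Landau bound is integrated over a length at most `2m`, whence `144 = 2·72`. -/
lemma setLIntegral_deriv_le {v v₁ v₂ : ℝ → ℝ} (h : IsJet v v₁ v₂) {m : ℕ} (hm : 1 ≤ m) {a b : ℝ}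
    (hab : (m : ℝ) / 2 ≤ b - a) (hab' : b - a ≤ 2 * m) :
    ∫⁻ x in Set.Icc a b, ‖v₁ x‖ₑ ≤ 144 * ∫⁻ x in Set.Icc a b, energy m v v₂ x := by
  have hm0 : (m : ℝ≥0∞) ≠ 0 := by exact_mod_cast (by omega : m ≠ 0)
  have hmi : (m : ℝ≥0∞) * (m : ℝ≥0∞)⁻¹ = 1 := ENNReal.mul_inv_cancel hm0 (ENNReal.natCast_ne_top m)
  have hvol : volume (Set.Icc a b) ≤ 2 * (m : ℝ≥0∞) := by
    rw [Real.volume_Icc]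
    refine (ENNReal.ofReal_le_ofReal hab').trans_eq ?_
    rw [ENNReal.ofReal_mul zero_le_two]; simp
  rw [setLIntegral_energy h.continuous]
  set A := ∫⁻ x in Set.Icc a b, ‖v x‖ₑ
  set B := ∫⁻ x in Set.Icc a b, ‖v₂ x‖ₑ
  calc ∫⁻ x in Set.Icc a b, ‖v₁ x‖ₑ ≤ ∫⁻ _ in Set.Icc a b, (72 * A / m / m + B) :=
        setLIntegral_mono' measurableSet_Icc fun x hx => enorm_deriv_le h hm hab hx
    _ = (72 * A / m / m + B) * volume (Set.Icc a b) := setLIntegral_const _ _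
    _ ≤ (72 * A / m / m + B) * (2 * m) := by gcongr
    _ = 144 * (A / m) * (m * (m : ℝ≥0∞)⁻¹) + 2 * (m * B) := by simp only [div_eq_mul_inv]; ring
    _ ≤ 144 * (A / m) + 144 * (m * B) := by
        rw [hmi, mul_one]
        gcongr
        norm_num
    _ = _ := by rw [mul_add]

/-- Multiplication by a function `w` with `|w| ≤ S`, `|w'| ≤ S / m`, `|w''| ≤ S / m²`. -/
lemma setLIntegral_energy_mul_le {v v₁ v₂ w w₁ w₂ : ℝ → ℝ} (h : IsJet v v₁ v₂) {m : ℕ} (hm : 1 ≤ m)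
    {a b : ℝ} (hab : (m : ℝ) / 2 ≤ b - a) (hab' : b - a ≤ 2 * m) {S : ℝ≥0∞}
    (hw : ∀ x ∈ Set.Icc a b, ‖w x‖ₑ ≤ S) (hw₁ : ∀ x ∈ Set.Icc a b, ‖w₁ x‖ₑ ≤ S / m)
    (hw₂ : ∀ x ∈ Set.Icc a b, ‖w₂ x‖ₑ ≤ S / m / m) :
    ∫⁻ x in Set.Icc a b, energy m (fun x => w x * v x)
      (fun x => w₂ x * v x + 2 * (w₁ x * v₁ x) + w x * v₂ x) x ≤
      290 * S * ∫⁻ x in Set.Icc a b, energy m v v₂ x := by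
  have hm0 : (m : ℝ≥0∞) ≠ 0 := by exact_mod_cast (by omega : m ≠ 0)
  have hmi : (m : ℝ≥0∞) * (m : ℝ≥0∞)⁻¹ = 1 := ENNReal.mul_inv_cancel hm0 (ENNReal.natCast_ne_top m)
  have hpt : ∀ x ∈ Set.Icc a b, energy m (fun x => w x * v x)
      (fun x => w₂ x * v x + 2 * (w₁ x * v₁ x) + w x * v₂ x) x ≤
      2 * S * energy m v v₂ x + 2 * S * ‖v₁ x‖ₑ := by
    intro x hx
    have h2 : ‖w₂ x * v x + 2 * (w₁ x * v₁ x) + w x * v₂ x‖ₑ ≤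
        S / m / m * ‖v x‖ₑ + 2 * (S / m * ‖v₁ x‖ₑ) + S * ‖v₂ x‖ₑ := by
      refine (enorm_add_le _ _).trans (add_le_add ((enorm_add_le _ _).trans
        (add_le_add ?_ ?_)) ?_)
      · rw [enorm_mul]; gcongr; exact hw₂ x hx
      · rw [enorm_mul, enorm_mul]
        gcongr
        · rw [Real.enorm_of_nonneg zero_le_two]; simp
        · exact hw₁ x hx
      · rw [enorm_mul]; gcongr; exact hw x hx
    unfold energy
    calc _ ≤ S * ‖v x‖ₑ / m + m * (S / m / m * ‖v x‖ₑ + 2 * (S / m * ‖v₁ x‖ₑ) + S * ‖v₂ x‖ₑ) := by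
          beta_reduce
          rw [enorm_mul]
          gcongr
          exact hw x hx
      _ = (S * ‖v x‖ₑ / m + S * ‖v x‖ₑ / m * (m * (m : ℝ≥0∞)⁻¹)) +
            2 * (S * ‖v₁ x‖ₑ) * (m * (m : ℝ≥0∞)⁻¹) + 1 * (S * (m * ‖v₂ x‖ₑ)) := by
          simp only [div_eq_mul_inv]; ring
      _ ≤ (S * ‖v x‖ₑ / m + S * ‖v x‖ₑ / m) + 2 * (S * ‖v₁ x‖ₑ) + 2 * (S * (m * ‖v₂ x‖ₑ)) := by
          rw [hmi, mul_one, mul_one]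
          gcongr
          norm_num
      _ = _ := by simp only [div_eq_mul_inv]; ring
  have hen : Measurable (energy m v v₂) := by
    unfold energy
    exact (h.continuous.enorm.measurable.div_const _).add
      (h.continuous₂.enorm.measurable.const_mul _)
  refine (setLIntegral_mono' measurableSet_Icc hpt).trans ?_
  rw [lintegral_add_left (hen.const_mul _), lintegral_const_mul _ hen,
    lintegral_const_mul _ h.continuous₁.enorm.measurable]
  -- The first-derivative term is absorbed by interpolation: `290 = 2 + 2·144`.
  calc _ ≤ 2 * S * (∫⁻ x in Set.Icc a b, energy m v v₂ x) +
        2 * S * (144 * ∫⁻ x in Set.Icc a b, energy m v v₂ x) := by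
        gcongr
        exact setLIntegral_deriv_le h hm hab hab'
    _ = _ := by ring

lemma tsum_setLIntegral_Icc_int (F : ℝ → ℝ≥0∞) :
    ∑' k : ℤ, ∫⁻ x in Set.Icc (k : ℝ) (k + 1), F x = ∫⁻ x, F x := by
  simp only [← restrict_Ioc_eq_restrict_Icc]
  rw [← lintegral_iUnion (fun _ => measurableSet_Ioc) (Set.pairwise_disjoint_Ioc_intCast ℝ),
    iUnion_Ioc_intCast, setLIntegral_univ]

/-- Sampling a `C²` function at the integers. -/
lemma coeffNorm_le_lintegral_energy {v v₁ v₂ : ℝ → ℝ} (h : IsJet v v₁ v₂) {m : ℕ} (hm : 1 ≤ m) :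
    coeffNorm m (fun k : ℤ => ((v k : ℝ) : ℂ)) ≤ 148 * ∫⁻ x, energy m v v₂ x := by
  have hm1 : (1 : ℝ≥0∞) ≤ m := by exact_mod_cast hm
  have hmi : (m : ℝ≥0∞)⁻¹ ≤ m := (ENNReal.inv_le_one.2 hm1).trans hm1
  have hreal : ∀ x : ℝ, ‖(x : ℂ)‖ₑ = ‖x‖ₑ := fun x => by
    rw [← ofReal_norm, ← ofReal_norm, Complex.norm_real]
  set A := ∫⁻ x, ‖v x‖ₑ with hA
  set B := ∫⁻ x, ‖v₂ x‖ₑ with hB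
  -- On each unit interval `v k` differs from an average value by at most `∫|v₁|`, which
  -- interpolation at scale `1` bounds by `144 ∫(|v| + |v₂|)`.
  have h0 : ∑' k : ℤ, ‖((v k : ℝ) : ℂ)‖ₑ ≤ 145 * A + 144 * B := by
    have hk : ∀ k : ℤ, ‖((v k : ℝ) : ℂ)‖ₑ ≤ 145 * (∫⁻ x in Set.Icc (k : ℝ) (k + 1), ‖v x‖ₑ) +
        144 * ∫⁻ x in Set.Icc (k : ℝ) (k + 1), ‖v₂ x‖ₑ := by
      intro k
      obtain ⟨s, hs, hvs⟩ := exists_enorm_le_average h.continuous (lt_add_one (k : ℝ))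
      have hd := setLIntegral_deriv_le h le_rfl (a := k) (b := k + 1) (by norm_num) (by norm_num)
      have ho := enorm_sub_le_setLIntegral h.hasDerivAt h.continuous₁
        (Set.left_mem_Icc.2 (lt_add_one (k : ℝ)).le) hs
      rw [setLIntegral_energy h.continuous] at hd
      simp only [add_sub_cancel_left, ENNReal.ofReal_one, div_one, Nat.cast_one, one_mul] at hvs hd
      rw [hreal]
      calc ‖v k‖ₑ = ‖v s + (v k - v s)‖ₑ := by ring_nf
        _ ≤ ‖v s‖ₑ + ‖v k - v s‖ₑ := enorm_add_le _ _
        _ ≤ _ := add_le_add hvs (ho.trans hd)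
        _ = _ := by ring
    refine (ENNReal.tsum_le_tsum hk).trans_eq ?_
    rw [ENNReal.tsum_add, ENNReal.tsum_mul_left, ENNReal.tsum_mul_left, tsum_setLIntegral_Icc_int,
      tsum_setLIntegral_Icc_int]
  -- By the mean value theorem the second difference is `v₁ η - v₁ ξ` with `ξ` and `η` in the two
  -- adjacent unit intervals; each interval is therefore counted twice in the sum.
  have h2 : ∑' k : ℤ, ‖((v (k + 1 : ℤ) : ℝ) : ℂ) - 2 * ((v k : ℝ) : ℂ) +
      ((v (k - 1 : ℤ) : ℝ) : ℂ)‖ₑ ≤ 2 * B := by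
    have hk : ∀ k : ℤ, ‖((v (k + 1 : ℤ) : ℝ) : ℂ) - 2 * ((v k : ℝ) : ℂ) +
        ((v (k - 1 : ℤ) : ℝ) : ℂ)‖ₑ ≤ (∫⁻ x in Set.Icc ((k - 1 : ℤ) : ℝ) ((k - 1 : ℤ) + 1), ‖v₂ x‖ₑ) +
          ∫⁻ x in Set.Icc (k : ℝ) (k + 1), ‖v₂ x‖ₑ := by
      intro k
      obtain ⟨ξ, hξ, h1⟩ := exists_hasDerivAt_eq_slope v v₁ (sub_one_lt (k : ℝ))
        h.continuous.continuousOn (fun x _ => h.hasDerivAt x)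
      obtain ⟨η, hη, h2⟩ := exists_hasDerivAt_eq_slope v v₁ (lt_add_one (k : ℝ))
        h.continuous.continuousOn (fun x _ => h.hasDerivAt x)
      have e : ((v (k + 1 : ℤ) : ℝ) : ℂ) - 2 * ((v k : ℝ) : ℂ) + ((v (k - 1 : ℤ) : ℝ) : ℂ) =
          (((v₁ η - v₁ k) + (v₁ k - v₁ ξ) : ℝ) : ℂ) := by
        rw [h1, h2]
        push_cast
        ring
      rw [e, hreal, add_comm]
      refine (enorm_add_le _ _).trans (add_le_add ?_ ?_)
      · push_cast
        rw [sub_add_cancel]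
        exact enorm_sub_le_setLIntegral h.hasDerivAt' h.continuous₂
          (Set.right_mem_Icc.2 (sub_one_lt _).le) (Set.Ioo_subset_Icc_self hξ)
      · exact enorm_sub_le_setLIntegral h.hasDerivAt' h.continuous₂
          (Set.Ioo_subset_Icc_self hη) (Set.left_mem_Icc.2 (lt_add_one _).le)
    refine (ENNReal.tsum_le_tsum hk).trans_eq ?_
    rw [ENNReal.tsum_add, tsum_setLIntegral_Icc_int, two_mul]
    congr 1
    exact ((Equiv.subRight (1 : ℤ)).tsum_eq
      (fun k : ℤ => ∫⁻ x in Set.Icc (k : ℝ) (k + 1), ‖v₂ x‖ₑ)).trans (tsum_setLIntegral_Icc_int _)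
  have hE := setLIntegral_energy (v₂ := v₂) h.continuous m Set.univ
  simp only [setLIntegral_univ] at hE
  rw [hE]
  unfold coeffNorm
  calc _ ≤ (145 * A + 144 * B) / m + m * (2 * B) := by gcongr
    _ = 145 * (A / m) + 144 * ((m : ℝ≥0∞)⁻¹ * B) + 2 * (m * B) := by
        simp only [div_eq_mul_inv]; ring
    _ ≤ 148 * (A / m) + 146 * (m * B) := by
        rw [show (146 : ℝ≥0∞) = 144 + 2 by norm_num, add_mul, ← add_assoc]
        gcongr
        norm_num
    _ ≤ _ := by
        rw [mul_add]
        gcongr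
        norm_num

/-! ### The tail integral and the dyadic shell -/

/-- On the tail the weight `m` is at most `|x|`. -/
lemma setLIntegral_energy_le_tailJ (ψ : ℝ → ℝ) {m : ℕ} (hm : 1 ≤ m) :
    ∫⁻ x in {x : ℝ | (m : ℝ) ≤ |x|}, energy m ψ (iteratedDeriv 2 ψ) x ≤ tailJ m ψ := by
  have hm0 : (m : ℝ) ≠ 0 := by exact_mod_cast (by omega : m ≠ 0)
  refine setLIntegral_mono' (measurableSet_le measurable_const measurable_abs) fun x hx => ?_
  unfold energy
  have hme : ‖(m : ℝ)‖ₑ = (m : ℝ≥0∞) := by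
    rw [Real.enorm_of_nonneg (Nat.cast_nonneg m)]; simp
  refine add_le_add (le_of_eq ?_) ?_
  · rw [div_eq_mul_inv (ψ x), enorm_mul, enorm_inv hm0, hme, div_eq_mul_inv]
  · rw [enorm_mul, ← hme]
    gcongr
    rw [← ofReal_norm, ← ofReal_norm, Real.norm_eq_abs, Real.norm_eq_abs, Nat.abs_cast]
    exact ENNReal.ofReal_le_ofReal hx

lemma tailJ_pos {ψ : ℝ → ℝ} (hψ : ∀ x, ψ x ≠ 0) (hc : Continuous ψ) {m : ℕ} (hm : 1 ≤ m) :
    tailJ m ψ ≠ 0 := by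
  have hm0 : (m : ℝ) ≠ 0 := by exact_mod_cast (by omega : m ≠ 0)
  have hset : MeasurableSet {x : ℝ | (m : ℝ) ≤ |x|} :=
    measurableSet_le measurable_const measurable_abs
  have hlt : 0 < ∫⁻ x in {x : ℝ | (m : ℝ) ≤ |x|}, ‖ψ x / (m : ℝ)‖ₑ := by
    rw [setLIntegral_pos_iff (by fun_prop)]
    have hsupp : Function.support (fun x => ‖ψ x / (m : ℝ)‖ₑ) = Set.univ := by
      ext x
      simp [hψ x, hm0]
    rw [hsupp, Set.univ_inter]
    refine lt_of_lt_of_le ?_ (measure_mono (s := Set.Icc (m : ℝ) (m + 1))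
      fun x hx => hx.1.trans (le_abs_self x))
    simp
  exact (hlt.trans_le (lintegral_mono fun x => le_self_add)).ne'

lemma lintegral_comp_half (f : ℝ → ℝ≥0∞) : ∫⁻ y, f (y / 2) = 2 * ∫⁻ x, f x := by
  have h := Real.map_volume_mul_left (a := (1 / 2 : ℝ)) (by norm_num)
  have h2 := (Homeomorph.mulLeft₀ (1 / 2 : ℝ) (by norm_num)).measurableEmbedding.lintegral_map
    (μ := volume) f
  simp only [Homeomorph.coe_mulLeft₀] at h2
  rw [h, lintegral_smul_measure] at h2
  simp only [one_div, inv_inv, abs_of_pos (zero_lt_two' ℝ), ENNReal.ofReal_ofNat, smul_eq_mul] at h2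
  rw [h2]
  exact lintegral_congr fun y => by rw [div_eq_inv_mul]

lemma measurable_energy {v v₂ : ℝ → ℝ} (hv : Continuous v) (hv₂ : Continuous v₂) (m : ℕ) :
    Measurable (energy m v v₂) := by
  unfold energy
  exact (hv.enorm.measurable.div_const _).add (hv₂.enorm.measurable.const_mul _)

/-- The dyadic shell `m / 2 ≤ |x| ≤ m`. -/
def shell (m : ℕ) : Set ℝ := {x : ℝ | (m : ℝ) / 2 ≤ |x| ∧ |x| ≤ m}

lemma measurableSet_shell (m : ℕ) : MeasurableSet (shell m) :=
  (measurableSet_le measurable_const measurable_abs).inter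
    (measurableSet_le measurable_abs measurable_const)

/-- Doubling maps the shell into the tail, and monotone type compares the values at `y/2` and `y`.
The condition `2R ≤ m` ensures `|y/2| ≥ m/2 ≥ R`. -/
lemma setLIntegral_shell_le_of_comparable {ψ : ℝ → ℝ} (hψ : ContDiff ℝ 2 ψ) {c₀ R : ℝ}
    (hc₀ : 0 < c₀) (hR : ∀ x y : ℝ, R ≤ |x| → R ≤ |y| →
      |x| ≤ 2 * |y| → |y| / 2 ≤ |x| →
      c₀ * |ψ y| ≤ |ψ x| ∧ c₀ * |iteratedDeriv 2 ψ y| ≤ |iteratedDeriv 2 ψ x|) {m : ℕ}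
    (hm : 1 ≤ m) (hmR : 2 * R ≤ m) :
    ∫⁻ x in shell m, energy m ψ (iteratedDeriv 2 ψ) x ≤ ENNReal.ofReal c₀⁻¹ * tailJ m ψ := by
  set E := energy m ψ (iteratedDeriv 2 ψ) with hE
  have hEm : Measurable E := measurable_energy hψ.continuous (hψ.continuous_iteratedDeriv 2 le_rfl) m
  have hmul : ∀ a b : ℝ, c₀ * |a| ≤ |b| → ‖a‖ₑ ≤ ENNReal.ofReal c₀⁻¹ * ‖b‖ₑ := by
    intro a b hab
    rw [← ofReal_norm, ← ofReal_norm, ← ENNReal.ofReal_mul (inv_nonneg.2 hc₀.le)]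
    refine ENNReal.ofReal_le_ofReal ?_
    rw [Real.norm_eq_abs, Real.norm_eq_abs, inv_mul_eq_div, le_div_iff₀ hc₀, mul_comm]
    exact hab
  have hpt : ∀ y : ℝ, y ∈ {x : ℝ | (m : ℝ) ≤ |x|} → E (y / 2) ≤ ENNReal.ofReal c₀⁻¹ * E y := by
    intro y hy
    have hy' : (m : ℝ) ≤ |y| := hy
    have h2 : |y / 2| = |y| / 2 := by rw [abs_div, abs_of_pos (zero_lt_two' ℝ)]
    have hm0 : (0 : ℝ) ≤ m := Nat.cast_nonneg m
    obtain ⟨h, h'⟩ := hR y (y / 2) (by linarith [abs_nonneg y]) (by rw [h2]; linarith)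
      (by rw [h2]; linarith) (by rw [h2]; linarith)
    simp only [hE, energy]
    calc _ ≤ (ENNReal.ofReal c₀⁻¹ * ‖ψ y‖ₑ) / m +
          m * (ENNReal.ofReal c₀⁻¹ * ‖iteratedDeriv 2 ψ y‖ₑ) := by
          gcongr
          · exact hmul _ _ h
          · exact hmul _ _ h'
      _ = _ := by simp only [div_eq_mul_inv]; ring
  have hset : MeasurableSet {x : ℝ | (m : ℝ) ≤ |x|} :=
    measurableSet_le measurable_const measurable_abs
  -- The otherwise wasteful factor `2` is the Jacobian of `y ↦ y/2`.
  calc ∫⁻ x in shell m, E x ≤ 2 * ∫⁻ x in shell m, E x := by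
        rw [two_mul]; exact le_self_add
    _ = ∫⁻ y, (shell m).indicator E (y / 2) := by
        rw [lintegral_comp_half, lintegral_indicator (measurableSet_shell m)]
    _ ≤ ∫⁻ y, {x : ℝ | (m : ℝ) ≤ |x|}.indicator (fun y => ENNReal.ofReal c₀⁻¹ * E y) y := by
        refine lintegral_mono fun y => ?_
        by_cases hy : y / 2 ∈ shell m
        · have hy' : y ∈ {x : ℝ | (m : ℝ) ≤ |x|} := by
            have := hy.1
            rw [abs_div, abs_of_pos (zero_lt_two' ℝ)] at this
            simp only [Set.mem_ofPred_eq]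
            linarith
          rw [Set.indicator_of_mem hy, Set.indicator_of_mem hy']
          exact hpt y hy'
        · rw [Set.indicator_of_notMem hy]
          exact zero_le
    _ = ENNReal.ofReal c₀⁻¹ * ∫⁻ y in {x : ℝ | (m : ℝ) ≤ |x|}, E y := by
        rw [lintegral_indicator hset, lintegral_const_mul _ hEm]
    _ ≤ _ := by
        gcongr
        exact setLIntegral_energy_le_tailJ ψ hm

lemma setLIntegral_shell_ne_top {ψ : ℝ → ℝ} (hψ : ContDiff ℝ 2 ψ) (m : ℕ) (hm : 1 ≤ m) :
    ∫⁻ x in shell m, energy m ψ (iteratedDeriv 2 ψ) x ≠ ∞ := by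
  have hsub : shell m ⊆ Set.Icc (-(m : ℝ)) m := fun x hx => abs_le.1 hx.2
  have hfin : ∀ {u : ℝ → ℝ}, Continuous u → ∫⁻ x in shell m, ‖u x‖ₑ ≠ ∞ := fun hu =>
    ((lintegral_mono_set hsub).trans_lt (hu.continuousOn.integrableOn_compact isCompact_Icc).2).ne
  have hm0 : (m : ℝ≥0∞) ≠ 0 := by exact_mod_cast (by omega : m ≠ 0)
  rw [setLIntegral_energy hψ.continuous]
  exact ENNReal.add_ne_top.2 ⟨ENNReal.div_ne_top (hfin hψ.continuous) hm0,
    ENNReal.mul_ne_top (ENNReal.natCast_ne_top m) (hfin (hψ.continuous_iteratedDeriv 2 le_rfl))⟩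

/-- Comparability covers all `m ≥ 2R`. For the finitely many smaller `m` the ratio of shell energy
to tail is finite, because the shell is compact and the tail does not vanish; these ratios are added
to the constant. -/
lemma exists_setLIntegral_shell_le {ψ : ℝ → ℝ} (hψ : IsMonotoneType ψ) (h0 : ∀ x, ψ x ≠ 0) :
    ∃ C : ℝ≥0∞, C ≠ ∞ ∧ ∀ m : ℕ, 1 ≤ m →
      ∫⁻ x in shell m, energy m ψ (iteratedDeriv 2 ψ) x ≤ C * tailJ m ψ := by
  obtain ⟨c₀, hc₀, R, -, hR⟩ := hψ.comparable
  set r : ℕ → ℝ≥0∞ := fun m =>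
    (∫⁻ x in shell m, energy m ψ (iteratedDeriv 2 ψ) x) / tailJ m ψ with hr
  set N := ⌈2 * R⌉₊
  refine ⟨ENNReal.ofReal c₀⁻¹ + ∑ m ∈ Finset.Ico 1 N, r m, ENNReal.add_ne_top.2
    ⟨ENNReal.ofReal_ne_top, ENNReal.sum_ne_top.2 fun m hm => ?_⟩, fun m hm => ?_⟩
  · have hm1 := (Finset.mem_Ico.1 hm).1
    exact ENNReal.div_ne_top (setLIntegral_shell_ne_top hψ.contDiff m hm1)
      (tailJ_pos h0 hψ.contDiff.continuous hm1)
  · rcases le_or_gt N m with h | h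
    · refine (setLIntegral_shell_le_of_comparable hψ.contDiff hc₀ hR hm (Nat.ceil_le.1 h)).trans ?_
      gcongr
      exact le_self_add
    -- With an infinite tail the bound is trivial only because the constant is nonzero, given `∞ · 0
    -- = 0`.
    · rcases eq_or_ne (tailJ m ψ) ∞ with ht | ht
      · rw [ht, ENNReal.mul_top]
        · exact le_top
        · simp [hc₀]
      · rw [← ENNReal.div_le_iff (tailJ_pos h0 hψ.contDiff.continuous hm) ht]
        exact (Finset.single_le_sum (f := r) (fun _ _ => zero_le)
          (Finset.mem_Ico.2 ⟨hm, h⟩)).trans le_add_self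

/-! ### The cut-off and the individual multipliers -/

lemma deriv_eq_zero_of_eqOn {θ : ℝ → ℝ} {U : Set ℝ} (hU : IsOpen U) {c : ℝ}
    (h : ∀ x ∈ U, θ x = c) {x : ℝ} (hx : x ∈ U) : deriv θ x = 0 ∧ iteratedDeriv 2 θ x = 0 := by
  have h1 : ∀ y ∈ U, deriv θ y = 0 := fun y hy => by
    have : θ =ᶠ[nhds y] fun _ => c := Filter.eventually_of_mem (hU.mem_nhds hy) h
    rw [this.deriv_eq, deriv_const]
  refine ⟨h1 x hx, ?_⟩
  have : deriv θ =ᶠ[nhds x] fun _ => 0 := Filter.eventually_of_mem (hU.mem_nhds hx) h1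
  rw [iteratedDeriv_succ, iteratedDeriv_one, this.deriv_eq, deriv_const]

namespace IsCutoff

variable {θ : ℝ → ℝ}

lemma eq_zero_of_one_lt (hθ : IsCutoff θ) {x : ℝ} (hx : 1 < |x|) :
    θ x = 0 ∧ deriv θ x = 0 ∧ iteratedDeriv 2 θ x = 0 := by
  have h : ∀ y ∈ {y : ℝ | 1 < |y|}, θ y = 0 := fun y hy =>
    hθ.eq_zero y fun hy' => absurd (abs_lt.2 hy') (not_lt.2 (le_of_lt hy))
  exact ⟨h x hx, deriv_eq_zero_of_eqOn (isOpen_lt continuous_const continuous_abs) h hx⟩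

lemma eq_one_of_lt_half (hθ : IsCutoff θ) {x : ℝ} (hx : |x| < 1 / 2) :
    θ x = 1 ∧ deriv θ x = 0 ∧ iteratedDeriv 2 θ x = 0 := by
  have h : ∀ y ∈ {y : ℝ | |y| < 1 / 2}, θ y = 1 := fun y hy =>
    hθ.eq_one y (abs_le.1 (le_of_lt hy))
  exact ⟨h x hx, deriv_eq_zero_of_eqOn (isOpen_lt continuous_abs continuous_const) h hx⟩

lemma exists_bound (hθ : IsCutoff θ) : ∃ D : ℝ≥0∞, D ≠ ∞ ∧ ∀ x ∈ Set.Icc (-1 : ℝ) 1,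
    ‖θ x‖ₑ ≤ D ∧ ‖deriv θ x‖ₑ ≤ D ∧ ‖iteratedDeriv 2 θ x‖ₑ ≤ D := by
  have hj := IsJet.of_contDiff hθ.contDiff
  have hb : ∀ {u : ℝ → ℝ}, Continuous u → ∃ D : ℝ, ∀ x ∈ Set.Icc (-1 : ℝ) 1, ‖u x‖ₑ ≤
      ENNReal.ofReal D := fun hu => by
    obtain ⟨D, hD⟩ := isCompact_Icc.exists_bound_of_continuousOn hu.continuousOn
    exact ⟨D, fun x hx => by rw [← ofReal_norm]; exact ENNReal.ofReal_le_ofReal (hD x hx)⟩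
  obtain ⟨D₀, h₀⟩ := hb hj.continuous
  obtain ⟨D₁, h₁⟩ := hb hj.continuous₁
  obtain ⟨D₂, h₂⟩ := hb hj.continuous₂
  refine ⟨ENNReal.ofReal D₀ + ENNReal.ofReal D₁ + ENNReal.ofReal D₂, by finiteness,
    fun x hx => ⟨(h₀ x hx).trans ?_, (h₁ x hx).trans ?_,
      (h₂ x hx).trans ?_⟩⟩
  · simp only [add_assoc]; exact le_self_add
  · simp only [add_assoc, add_left_comm _ (ENNReal.ofReal D₁)]; exact le_self_add
  · exact le_add_self

end IsCutoff

lemma enorm_div_natCast {m : ℕ} (hm : 1 ≤ m) (x : ℝ) : ‖x / (m : ℝ)‖ₑ = ‖x‖ₑ / m := by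
  have hm0 : (m : ℝ) ≠ 0 := by exact_mod_cast (by omega : m ≠ 0)
  rw [div_eq_mul_inv, enorm_mul, enorm_inv hm0, Real.enorm_of_nonneg (Nat.cast_nonneg m),
    ENNReal.ofReal_natCast, div_eq_mul_inv]

lemma abs_div_natCast (m : ℕ) (x : ℝ) : |x / (m : ℝ)| = |x| / m := by
  rw [abs_div, Nat.abs_cast]

/-- The high frequency part of the error. -/
lemma exists_coeffNorm_high_le {θ lam : ℝ → ℝ} (hθ : IsCutoff θ) (hlam : IsMonotoneType lam)
    (h0 : ∀ x, lam x ≠ 0) : ∃ C : ℝ≥0∞, C ≠ ∞ ∧ ∀ m : ℕ, 1 ≤ m →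
      coeffNorm m (fun k : ℤ => (((1 - θ ((k : ℝ) / m)) * lam k : ℝ) : ℂ)) ≤ C * tailJ m lam := by
  obtain ⟨C, hC, hshell⟩ := exists_setLIntegral_shell_le hlam h0
  obtain ⟨D, hD, hDb⟩ := hθ.exists_bound
  refine ⟨148 * (290 * (1 + D) * C + 290 * (1 + D) * C + 1), by finiteness, fun m hm => ?_⟩
  have hm0 : (0 : ℝ) < m := by exact_mod_cast hm
  have hjl := IsJet.of_contDiff hlam.contDiff
  have hjw := ((IsJet.of_contDiff hθ.contDiff).comp_div (m : ℝ)).one_sub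
  refine (coeffNorm_le_lintegral_energy (hjw.mul hjl) hm).trans ?_
  rw [mul_assoc]
  gcongr
  set E := energy m (fun x => (1 - θ (x / m)) * lam x) (fun x =>
    -(iteratedDeriv 2 θ (x / m) / (m : ℝ) ^ 2) * lam x +
      2 * (-(deriv θ (x / m) / m) * deriv lam x) + (1 - θ (x / m)) * iteratedDeriv 2 lam x) with hE
  -- Each half of the shell has length exactly `m/2`, the least that the product estimate allows.
  -- There `1 - θ(·/m)` and its scaled derivatives are bounded by `1 + D`.
  have hmid : ∀ a b : ℝ, b - a = m / 2 → Set.Icc a b ⊆ shell m →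
      ∫⁻ x in Set.Icc a b, E x ≤ 290 * (1 + D) * (C * tailJ m lam) := by
    intro a b hab hsub
    have hmem : ∀ x ∈ Set.Icc a b, x / (m : ℝ) ∈ Set.Icc (-1 : ℝ) 1 := fun x hx => by
      rw [Set.mem_Icc, ← abs_le, abs_div_natCast, div_le_one hm0]
      exact (hsub hx).2
    refine (setLIntegral_energy_mul_le hjl hm hab.ge (by linarith) (S := 1 + D) ?_ ?_ ?_).trans ?_
    · intro x hx
      refine enorm_sub_le.trans (add_le_add (by simp) (hDb _ (hmem x hx)).1)
    · intro x hx
      rw [enorm_neg, enorm_div_natCast hm]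
      gcongr
      exact (hDb _ (hmem x hx)).2.1.trans le_add_self
    · intro x hx
      rw [enorm_neg, pow_two, ← div_div, enorm_div_natCast hm, enorm_div_natCast hm]
      gcongr
      exact (hDb _ (hmem x hx)).2.2.trans le_add_self
    · gcongr
      exact (lintegral_mono_set hsub).trans (hshell m hm)
  have hinner : ∫⁻ x in {x : ℝ | |x| < m / 2}, E x = 0 := by
    rw [setLIntegral_congr_fun (g := fun _ => 0)
      (measurableSet_lt measurable_abs measurable_const), lintegral_zero]
    intro x hx
    obtain ⟨h1, h2, h3⟩ := hθ.eq_one_of_lt_half (x := x / m) (by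
      rw [abs_div_natCast, div_lt_iff₀ hm0]
      have : |x| < m / 2 := hx
      linarith)
    simp [hE, energy, h1, h2, h3]
  have houter : ∫⁻ x in {x : ℝ | (m : ℝ) < |x|}, E x ≤ tailJ m lam := by
    refine le_trans ?_ ((lintegral_mono_set fun x (hx : (m : ℝ) < |x|) => hx.le).trans
      (setLIntegral_energy_le_tailJ lam hm))
    refine setLIntegral_mono' (measurableSet_lt measurable_const measurable_abs) fun x hx => ?_
    obtain ⟨h1, h2, h3⟩ := hθ.eq_zero_of_one_lt (x := x / m) (by
      rw [abs_div_natCast, one_lt_div hm0]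
      exact hx)
    simp [hE, energy, h1, h2, h3]
  have hcover : (Set.univ : Set ℝ) ⊆ {x : ℝ | |x| < m / 2} ∪ (Set.Icc (-(m : ℝ)) (-(m / 2)) ∪
      (Set.Icc ((m : ℝ) / 2) m ∪ {x : ℝ | (m : ℝ) < |x|})) := by
    intro x _
    simp only [Set.mem_union, Set.mem_ofPred_eq, Set.mem_Icc]
    by_cases h1 : |x| < m / 2
    · exact Or.inl h1
    by_cases h2 : (m : ℝ) < |x|
    · exact Or.inr (Or.inr (Or.inr h2))
    rcases abs_cases x with ⟨h, -⟩ | ⟨h, -⟩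
    · exact Or.inr (Or.inr (Or.inl ⟨by linarith, by linarith⟩))
    · exact Or.inr (Or.inl ⟨by linarith, by linarith⟩)
  have hneg := hmid (-(m : ℝ)) (-(m / 2)) (by ring) (fun x hx => by
    have hx0 : x ≤ 0 := by linarith [hx.2]
    simp only [shell, Set.mem_ofPred_eq, abs_of_nonpos hx0]
    exact ⟨by linarith [hx.2], by linarith [hx.1]⟩)
  have hpos := hmid ((m : ℝ) / 2) m (by ring) (fun x hx => by
    have hx0 : 0 ≤ x := by linarith [hx.1]
    simp only [shell, Set.mem_ofPred_eq, abs_of_nonneg hx0]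
    exact hx)
  calc ∫⁻ x, E x = ∫⁻ x in Set.univ, E x := (setLIntegral_univ _).symm
    _ ≤ _ := lintegral_mono_set hcover
    _ ≤ _ := (lintegral_union_le _ _ _).trans (add_le_add le_rfl
      ((lintegral_union_le _ _ _).trans (add_le_add le_rfl (lintegral_union_le _ _ _))))
    _ ≤ 0 + (290 * (1 + D) * (C * tailJ m lam) + (290 * (1 + D) * (C * tailJ m lam) + tailJ m lam)) :=
        add_le_add hinner.le (add_le_add hneg (add_le_add hpos houter))
    _ = _ := by ring

/-- The weight `sup_{|x| ≤ m} (|G(x)| + m² sup_{|y| ≤ m} |G''(y)|)` of the low frequency part. -/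
noncomputable def quotSup (G : ℝ → ℝ) (m : ℕ) : ℝ≥0∞ :=
  ⨆ x ∈ Set.Icc (-(m : ℝ)) (m : ℝ),
    (‖G x‖ₑ + (m : ℝ≥0∞) ^ 2 * ⨆ y ∈ Set.Icc (-(m : ℝ)) (m : ℝ), ‖iteratedDeriv 2 G y‖ₑ)

lemma epsilon_eq (lam β : ℝ → ℝ) (m : ℕ) :
    epsilon lam β m = tailJ m lam + quotSup (quot lam β) m * tailJ m β := rfl

lemma natCast_mul_inv_cancel {m : ℕ} (hm : 1 ≤ m) : (m : ℝ≥0∞) * (m : ℝ≥0∞)⁻¹ = 1 :=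
  ENNReal.mul_inv_cancel (by exact_mod_cast (by omega : m ≠ 0)) (ENNReal.natCast_ne_top m)

lemma enorm_le_quotSup {G : ℝ → ℝ} {m : ℕ} {x : ℝ} (hx : x ∈ Set.Icc (-(m : ℝ)) (m : ℝ)) :
    ‖G x‖ₑ ≤ quotSup G m :=
  le_self_add.trans (le_iSup₂_of_le (f := fun x (_ : x ∈ Set.Icc (-(m : ℝ)) (m : ℝ)) =>
    (‖G x‖ₑ + (m : ℝ≥0∞) ^ 2 * ⨆ y ∈ Set.Icc (-(m : ℝ)) (m : ℝ), ‖iteratedDeriv 2 G y‖ₑ))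
    x hx le_rfl)

lemma enorm_iteratedDeriv_le_quotSup {G : ℝ → ℝ} {m : ℕ} (hm : 1 ≤ m) {x : ℝ}
    (hx : x ∈ Set.Icc (-(m : ℝ)) (m : ℝ)) :
    ‖iteratedDeriv 2 G x‖ₑ ≤ quotSup G m / m / m := by
  have h : (m : ℝ≥0∞) ^ 2 * ‖iteratedDeriv 2 G x‖ₑ ≤ quotSup G m := by
    refine le_trans ?_ (le_iSup₂_of_le (f := fun x (_ : x ∈ Set.Icc (-(m : ℝ)) (m : ℝ)) =>
      (‖G x‖ₑ + (m : ℝ≥0∞) ^ 2 * ⨆ y ∈ Set.Icc (-(m : ℝ)) (m : ℝ), ‖iteratedDeriv 2 G y‖ₑ))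
      x hx le_rfl)
    refine le_trans ?_ le_add_self
    gcongr
    exact le_iSup₂_of_le (f := fun y (_ : y ∈ Set.Icc (-(m : ℝ)) (m : ℝ)) =>
      ‖iteratedDeriv 2 G y‖ₑ) x hx le_rfl
  calc ‖iteratedDeriv 2 G x‖ₑ = (m : ℝ≥0∞) ^ 2 * ‖iteratedDeriv 2 G x‖ₑ / m / m := by
        simp only [div_eq_mul_inv]
        rw [show (m : ℝ≥0∞) ^ 2 * ‖iteratedDeriv 2 G x‖ₑ * (m : ℝ≥0∞)⁻¹ * (m : ℝ≥0∞)⁻¹ =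
          (m * (m : ℝ≥0∞)⁻¹) ^ 2 * ‖iteratedDeriv 2 G x‖ₑ by ring, natCast_mul_inv_cancel hm]
        simp
    _ ≤ _ := by gcongr

/-- Interpolation on `[-m, m]` bounds `G'` by the suprema of `G` and `G''`, which is why no first
derivative occurs in `epsilon`. The constant is `146 = 2·72 + 2`. -/
lemma enorm_deriv_le_quotSup {G : ℝ → ℝ} (hG : ContDiff ℝ 2 G) {m : ℕ} (hm : 1 ≤ m) {x : ℝ}
    (hx : x ∈ Set.Icc (-(m : ℝ)) (m : ℝ)) :
    ‖deriv G x‖ₑ ≤ 146 * (quotSup G m / m) := by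
  have hm0 : (0 : ℝ) < m := by exact_mod_cast hm
  set S := quotSup G m
  have hvol : volume (Set.Icc (-(m : ℝ)) m) = 2 * (m : ℝ≥0∞) := by
    rw [Real.volume_Icc, sub_neg_eq_add, ← two_mul, ENNReal.ofReal_mul zero_le_two]; simp
  have hA : ∫⁻ t in Set.Icc (-(m : ℝ)) m, ‖G t‖ₑ ≤ S * (2 * m) := by
    rw [← hvol, ← setLIntegral_const]
    exact setLIntegral_mono' measurableSet_Icc fun t ht => enorm_le_quotSup ht
  have hB : ∫⁻ t in Set.Icc (-(m : ℝ)) m, ‖iteratedDeriv 2 G t‖ₑ ≤ S / m / m * (2 * m) := by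
    rw [← hvol, ← setLIntegral_const]
    exact setLIntegral_mono' measurableSet_Icc fun t ht => enorm_iteratedDeriv_le_quotSup hm ht
  calc ‖deriv G x‖ₑ ≤ _ := enorm_deriv_le (IsJet.of_contDiff hG) hm (by linarith) hx
    _ ≤ 72 * (S * (2 * m)) / m / m + S / m / m * (2 * m) := by gcongr
    _ = 146 * (S / m) * (m * (m : ℝ≥0∞)⁻¹) := by simp only [div_eq_mul_inv]; ring
    _ = _ := by rw [natCast_mul_inv_cancel hm, mul_one]

/-- The aliasing part of the error coming from a single translate of the frequency window. -/
lemma exists_coeffNorm_low_le {θ G β : ℝ → ℝ} (hθ : IsCutoff θ) (hG : ContDiff ℝ 2 G)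
    (hβ : ContDiff ℝ 2 β) : ∃ C : ℝ≥0∞, C ≠ ∞ ∧ ∀ m : ℕ, 1 ≤ m → ∀ s : ℝ,
      coeffNorm m (fun k : ℤ => ((-(θ ((k : ℝ) / m) * G k) * β (k + s) : ℝ) : ℂ)) ≤
        C * quotSup G m * ∫⁻ x in Set.Icc (-(m : ℝ)) m, energy m β (iteratedDeriv 2 β) (x + s) := by
  obtain ⟨D, hD, hDb⟩ := hθ.exists_bound
  -- The factors come from sampling (`148`), the product estimate (`290`) and the second derivative
  -- of `θ(·/m) G`, where `294 = 1 + 2·146 + 1`.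
  refine ⟨148 * (290 * (294 * D)), by finiteness, fun m hm s => ?_⟩
  have hm0 : (0 : ℝ) < m := by exact_mod_cast hm
  set S := quotSup G m
  have hjb := (IsJet.of_contDiff hβ).comp_add_const s
  have hjw := (((IsJet.of_contDiff hθ.contDiff).comp_div (m : ℝ)).mul (IsJet.of_contDiff hG)).neg
  refine (coeffNorm_le_lintegral_energy (hjw.mul hjb) hm).trans ?_
  rw [mul_assoc, mul_assoc]
  gcongr
  have hmem : ∀ x ∈ Set.Icc (-(m : ℝ)) m, x / (m : ℝ) ∈ Set.Icc (-1 : ℝ) 1 := fun x hx => by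
    rw [Set.mem_Icc, ← abs_le, abs_div_natCast, div_le_one hm0]
    exact abs_le.2 hx
  have h2 : ‖(2 : ℝ)‖ₑ = 2 := by rw [Real.enorm_of_nonneg zero_le_two]; simp
  refine le_trans ?_ ((setLIntegral_energy_mul_le hjb hm (a := -(m : ℝ)) (b := m) (by linarith)
    (by linarith) (S := 294 * D * S) (w := fun x => -(θ (x / m) * G x))
    (w₁ := fun x => -(deriv θ (x / m) / m * G x + θ (x / m) * deriv G x))
    (w₂ := fun x => -(iteratedDeriv 2 θ (x / m) / (m : ℝ) ^ 2 * G x +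
      2 * (deriv θ (x / m) / m * deriv G x) + θ (x / m) * iteratedDeriv 2 G x)) ?_ ?_ ?_).trans_eq ?_)
  -- Outside `[-m, m]` the cut-off and its derivatives vanish, so the energy of the product lives on
  -- the window.
  · rw [← lintegral_indicator measurableSet_Icc]
    refine lintegral_mono fun x => ?_
    by_cases hx : x ∈ Set.Icc (-(m : ℝ)) m
    · rw [Set.indicator_of_mem hx]
    · obtain ⟨e1, e2, e3⟩ := hθ.eq_zero_of_one_lt (x := x / m) (by
        rw [abs_div_natCast, one_lt_div hm0]
        exact not_le.1 fun h => hx (abs_le.1 h))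
      simp [energy, e1, e2, e3]
  · intro x hx
    rw [enorm_neg, enorm_mul]
    calc ‖θ (x / m)‖ₑ * ‖G x‖ₑ ≤ D * S := mul_le_mul' (hDb _ (hmem x hx)).1 (enorm_le_quotSup hx)
      _ ≤ 294 * D * S := by
        rw [mul_assoc]
        exact le_mul_of_one_le_left zero_le (by norm_num)
  · intro x hx
    obtain ⟨d0, d1, -⟩ := hDb _ (hmem x hx)
    rw [enorm_neg]
    calc _ ≤ ‖deriv θ (x / m)‖ₑ / m * ‖G x‖ₑ + ‖θ (x / m)‖ₑ * ‖deriv G x‖ₑ := by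
          refine (enorm_add_le _ _).trans_eq ?_
          rw [enorm_mul, enorm_mul, enorm_div_natCast hm]
      _ ≤ D / m * S + D * (146 * (S / m)) := by
          gcongr
          · exact enorm_le_quotSup hx
          · exact enorm_deriv_le_quotSup hG hm hx
      _ = 147 * (D * S / m) := by simp only [div_eq_mul_inv]; ring
      _ ≤ 294 * (D * S / m) := by gcongr; norm_num
      _ = _ := by simp only [div_eq_mul_inv]; ring
  · intro x hx
    obtain ⟨d0, d1, d2⟩ := hDb _ (hmem x hx)
    rw [enorm_neg]
    calc _ ≤ ‖iteratedDeriv 2 θ (x / m)‖ₑ / m / m * ‖G x‖ₑ +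
          2 * (‖deriv θ (x / m)‖ₑ / m * ‖deriv G x‖ₑ) +
          ‖θ (x / m)‖ₑ * ‖iteratedDeriv 2 G x‖ₑ := by
          refine (enorm_add_le _ _).trans (add_le_add ((enorm_add_le _ _).trans_eq ?_) (enorm_mul _ _).le)
          rw [enorm_mul, enorm_mul, enorm_mul, pow_two, ← div_div, enorm_div_natCast hm,
            enorm_div_natCast hm, enorm_div_natCast hm, h2]
      _ ≤ D / m / m * S + 2 * (D / m * (146 * (S / m))) + D * (S / m / m) := by
          gcongr
          · exact enorm_le_quotSup hx
          · exact enorm_deriv_le_quotSup hG hm hx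
          · exact enorm_iteratedDeriv_le_quotSup hm hx
      _ = _ := by simp only [div_eq_mul_inv]; ring
  · unfold energy
    simp only [mul_assoc]

/-! ### Summation over the frequency windows -/

lemma setLIntegral_Icc_add (F : ℝ → ℝ≥0∞) (a b s : ℝ) :
    ∫⁻ x in Set.Icc a b, F (x + s) = ∫⁻ x in Set.Icc (a + s) (b + s), F x := by
  have h := (measurePreserving_add_right (volume : Measure ℝ) s).setLIntegral_comp_preimage_emb
    (measurableEmbedding_addRight s) F (Set.Icc (a + s) (b + s))
  simpa using h

/-- Centres are `2m+1` apart and radii are `m`, so the windows are pairwise disjoint; those with `j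
≠ 0` begin at distance `m+1` from the origin. -/
lemma tsum_setLIntegral_window_le (F : ℝ → ℝ≥0∞) (m : ℕ) :
    ∑' j : ℤ, (if j = 0 then 0 else
      ∫⁻ x in Set.Icc (-(m : ℝ)) m, F (x + (2 * m + 1) * j)) ≤
      ∫⁻ x in {x : ℝ | (m : ℝ) ≤ |x|}, F x := by
  set W : ℤ → Set ℝ := fun j =>
    if j = 0 then ∅ else Set.Icc (-(m : ℝ) + (2 * m + 1) * j) (m + (2 * m + 1) * j) with hW
  have hm0 : (0 : ℝ) ≤ m := Nat.cast_nonneg m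
  have hterm : ∀ j : ℤ, (if j = 0 then 0 else
      ∫⁻ x in Set.Icc (-(m : ℝ)) m, F (x + (2 * m + 1) * j)) = ∫⁻ x in W j, F x := by
    intro j
    by_cases hj : j = 0
    · simp [hW, hj]
    · simp only [hW, hj, if_false]
      exact setLIntegral_Icc_add F _ _ _
  have hmeas : ∀ j, MeasurableSet (W j) := by
    intro j
    by_cases hj : j = 0
    · simp [hW, hj]
    · simp only [hW, hj, if_false]
      exact measurableSet_Icc
  have hmem : ∀ {j : ℤ} {x : ℝ}, x ∈ W j →
      j ≠ 0 ∧ -(m : ℝ) + (2 * m + 1) * j ≤ x ∧ x ≤ m + (2 * m + 1) * j := by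
    intro j x hx
    by_cases hj : j = 0
    · simp [hW, hj] at hx
    · simp only [hW, hj, if_false] at hx
      exact ⟨hj, hx⟩
  have hdisj : Pairwise (Function.onFun Disjoint W) := by
    have key : ∀ i j : ℤ, i < j → Disjoint (W i) (W j) := by
      intro i j hij
      refine Set.disjoint_left.2 fun x hi hj => ?_
      have h1 := (hmem hi).2.2
      have h2 := (hmem hj).2.1
      have h3 : (i : ℝ) + 1 ≤ j := by exact_mod_cast hij
      nlinarith
    intro i j hij
    rcases lt_or_gt_of_ne hij with h | h
    · exact key i j h
    · exact (key j i h).symm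
  simp only [hterm]
  rw [← lintegral_iUnion hmeas hdisj]
  refine lintegral_mono_set fun x hx => ?_
  obtain ⟨j, hj⟩ := Set.mem_iUnion.1 hx
  obtain ⟨hj0, h1, h2⟩ := hmem hj
  change (m : ℝ) ≤ |x|
  rcases lt_or_gt_of_ne hj0 with h | h
  · have h3 : (j : ℝ) ≤ -1 := by exact_mod_cast (by omega : j ≤ -1)
    exact (by nlinarith : (m : ℝ) ≤ -x).trans (neg_le_abs x)
  · have h3 : (1 : ℝ) ≤ j := by exact_mod_cast (by omega : 1 ≤ j)
    exact (by nlinarith : (m : ℝ) ≤ x).trans (le_abs_self x)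

/-- The multiplier sequences whose modulated superposition is the error `f - Q_{m,β}(f)`. -/
noncomputable def errorCoeff (θ lam β : ℝ → ℝ) (m : ℕ) (j k : ℤ) : ℂ :=
  if j = 0 then (((1 - θ ((k : ℝ) / m)) * lam k : ℝ) : ℂ)
  else ((-(θ ((k : ℝ) / m) * quot lam β k) * β (k + (2 * m + 1) * j) : ℝ) : ℂ)

lemma exists_tsum_coeffNorm_errorCoeff_le {θ lam β : ℝ → ℝ} (hθ : IsCutoff θ)
    (hlam_ne : ∀ x, lam x ≠ 0) (hβ_ne : ∀ x, β x ≠ 0) (hlam : IsMonotoneType lam)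
    (hβ : ContDiff ℝ 2 β) : ∃ C : ℝ≥0∞, C ≠ ∞ ∧ ∀ m : ℕ, 1 ≤ m →
      ∑' j, coeffNorm m (errorCoeff θ lam β m j) ≤ C * epsilon lam β m := by
  obtain ⟨C₁, hC₁, h₁⟩ := exists_coeffNorm_high_le hθ hlam hlam_ne
  obtain ⟨C₂, hC₂, h₂⟩ := exists_coeffNorm_low_le hθ (hlam.contDiff.div hβ hβ_ne) hβ
  refine ⟨C₁ + C₂, by finiteness, fun m hm => ?_⟩
  set S := quotSup (quot lam β) m with hS
  have hterm : ∀ j, coeffNorm m (errorCoeff θ lam β m j) ≤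
      (if j = 0 then C₁ * tailJ m lam else 0) + C₂ * S * (if j = 0 then 0 else
        ∫⁻ x in Set.Icc (-(m : ℝ)) m, energy m β (iteratedDeriv 2 β) (x + (2 * m + 1) * j)) := by
    intro j
    by_cases hj : j = 0
    · have e : errorCoeff θ lam β m j = fun k : ℤ => (((1 - θ ((k : ℝ) / m)) * lam k : ℝ) : ℂ) :=
        funext fun k => if_pos hj
      rw [e, if_pos hj, if_pos hj, mul_zero, add_zero]
      exact h₁ m hm
    · have e : errorCoeff θ lam β m j = fun k : ℤ =>
          ((-(θ ((k : ℝ) / m) * quot lam β k) * β (k + (2 * m + 1) * j) : ℝ) : ℂ) :=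
        funext fun k => if_neg hj
      rw [e, if_neg hj, if_neg hj, zero_add]
      exact h₂ m hm _
  refine (ENNReal.tsum_le_tsum hterm).trans ?_
  rw [ENNReal.tsum_add, tsum_ite_eq, ENNReal.tsum_mul_left, epsilon_eq]
  calc _ ≤ C₁ * tailJ m lam + C₂ * S * tailJ m β := by
        gcongr
        exact (tsum_setLIntegral_window_le _ m).trans (setLIntegral_energy_le_tailJ β hm)
    _ ≤ (C₁ + C₂) * tailJ m lam + (C₁ + C₂) * (S * tailJ m β) := by
        rw [mul_assoc]
        gcongr
        · exact le_self_add
        · exact le_add_self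
    _ = _ := by rw [mul_add]

/-! ### Aliasing at the nodes -/

/-- A geometric sum of powers of a `(2m+1)`-th root of unity, which equals `1` exactly when `2m+1`
divides `q`. -/
lemma sum_fourier_node (m : ℕ) (q : ℤ) :
    ∑ l ∈ Finset.range (2 * m + 1), fourier q (node m l : Torus) =
      if (2 * m + 1 : ℤ) ∣ q then (2 * m + 1 : ℂ) else 0 := by
  set ζ : ℂ := Complex.exp (2 * Real.pi * Complex.I * (q / (2 * m + 1))) with hζ
  have hn : (2 * m + 1 : ℂ) ≠ 0 := by exact_mod_cast (Nat.succ_ne_zero (2 * m))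
  have hpi : (Real.pi : ℂ) ≠ 0 := by exact_mod_cast Real.pi_ne_zero
  have hpow : ∀ l : ℕ, fourier q (node m l : Torus) = ζ ^ l := by
    intro l
    rw [fourier_coe_apply, hζ, ← Complex.exp_nat_mul, node]
    congr 1
    push_cast
    field_simp
  simp only [hpow]
  have hone : ζ ^ (2 * m + 1) = 1 := by
    rw [hζ, ← Complex.exp_nat_mul, Complex.exp_eq_one_iff]
    refine ⟨q, ?_⟩
    push_cast
    field_simp
  split_ifs with h
  · obtain ⟨r, rfl⟩ := h
    have : ζ = 1 := by
      rw [hζ, Complex.exp_eq_one_iff]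
      refine ⟨r, ?_⟩
      push_cast
      field_simp
    simp [this]
  · have hne : ζ ≠ 1 := by
      intro h1
      rw [hζ, Complex.exp_eq_one_iff] at h1
      obtain ⟨r, hr⟩ := h1
      refine h ⟨r, ?_⟩
      have hI := Complex.I_ne_zero
      field_simp at hr
      have : (q : ℂ) = ((2 * m + 1 : ℤ) * r : ℤ) := by
        push_cast
        linear_combination hr
      exact_mod_cast this
    rw [geom_sum_eq hne, hone, sub_self, zero_div]

/-- The Fourier coefficients of `V_m(g)`. -/
noncomputable def coeffV (θ lam β : ℝ → ℝ) (m : ℕ) (g : Torus → ℂ) (k : ℤ) : ℂ :=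
  ((θ ((k : ℝ) / m) * quot lam β k : ℝ) : ℂ) * fourierCoeff g k

lemma opV_eq {θ lam β : ℝ → ℝ} (m : ℕ) {g : Torus → ℂ} (hg : Integrable g torusMeasure)
    (x : Torus) : opV θ lam β m g x =
      ∑ k ∈ Finset.Icc (-(m : ℤ)) m, coeffV θ lam β m g k * fourier k x := by
  simp only [opV, kernelH, Finset.sum_mul, mul_assoc]
  rw [integral_finsetSum _ fun k _ => (integrable_fourier_sub_mul hg k x).const_mul _]
  refine Finset.sum_congr rfl fun k _ => ?_
  rw [integral_const_mul, integral_fourier_sub_mul, coeffV]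
  ring

lemma opQ_apply {θ lam β : ℝ → ℝ} (m : ℕ) {g : Torus → ℂ} (hg : Integrable g torusMeasure)
    (k : ℤ) : opQ θ lam β m g k = β k *
      ∑ i ∈ Finset.Icc (-(m : ℤ)) m,
        if (2 * m + 1 : ℤ) ∣ i - k then coeffV θ lam β m g i else 0 := by
  have hn : (2 * m + 1 : ℂ) ≠ 0 := by exact_mod_cast (Nat.succ_ne_zero (2 * m))
  simp only [opQ, Pi.smul_apply, Finset.sum_apply, smul_eq_mul, translate, phi, opV_eq m hg]
  have h : ∀ l ∈ Finset.range (2 * m + 1),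
      (∑ i ∈ Finset.Icc (-(m : ℤ)) m, coeffV θ lam β m g i * fourier i (node m l : Torus)) *
        (fourier (-k) (node m l : Torus) * (β k : ℂ)) =
      ∑ i ∈ Finset.Icc (-(m : ℤ)) m, β k * coeffV θ lam β m g i *
        fourier (i - k) (node m l : Torus) := by
    intro l _
    rw [Finset.sum_mul]
    refine Finset.sum_congr rfl fun i _ => ?_
    rw [sub_eq_add_neg, fourier_add]
    ring
  rw [Finset.sum_congr rfl h, Finset.sum_comm, Finset.mul_sum, Finset.mul_sum]
  refine Finset.sum_congr rfl fun i _ => ?_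
  rw [← Finset.mul_sum, sum_fourier_node]
  split_ifs
  · field_simp
  · simp

lemma coeffV_eq_zero {θ lam β : ℝ → ℝ} (hθ : IsCutoff θ) {m : ℕ} (hm : 1 ≤ m) (g : Torus → ℂ)
    {k : ℤ} (hk : k ∉ Finset.Icc (-(m : ℤ)) m) : coeffV θ lam β m g k = 0 := by
  have hm0 : (0 : ℝ) < m := by exact_mod_cast hm
  have : θ ((k : ℝ) / m) = 0 := (hθ.eq_zero_of_one_lt (by
    rw [abs_div_natCast, one_lt_div hm0]
    rw [Finset.mem_Icc, ← abs_le, not_le] at hk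
    exact_mod_cast hk)).1
  simp [coeffV, this]

/-- `[-m, m]` contains exactly one representative of each class modulo `2m+1`, so both sums reduce
to the same single term. The representative of `k` is reached at `j₀ = ⌊(k+m)/(2m+1)⌋`. -/
lemma hasSum_coeffV {θ lam β : ℝ → ℝ} (hθ : IsCutoff θ) {m : ℕ} (hm : 1 ≤ m) (g : Torus → ℂ)
    (k : ℤ) : HasSum (fun j : ℤ => coeffV θ lam β m g (k + -((2 * m + 1) * j)))
      (∑ i ∈ Finset.Icc (-(m : ℤ)) m,
        if (2 * m + 1 : ℤ) ∣ i - k then coeffV θ lam β m g i else 0) := by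
  set n : ℤ := 2 * m + 1 with hn
  have hn0 : 0 < n := by omega
  set j₀ := (k + m) / n with hj₀
  have h1 := Int.emod_nonneg (k + m) hn0.ne'
  have h2 := Int.emod_lt_of_pos (k + m) hn0
  have h3 := Int.mul_ediv_add_emod (k + m) n
  rw [← hj₀] at h3
  have huniq : ∀ j : ℤ, k + -(n * j) ∈ Finset.Icc (-(m : ℤ)) m → j = j₀ := by
    intro j hj
    rw [Finset.mem_Icc] at hj
    rcases lt_trichotomy j j₀ with h | h | h
    · have : n * (j + 1) ≤ n * j₀ := Int.mul_le_mul_of_nonneg_left (by omega) hn0.le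
      rw [mul_add] at this
      omega
    · exact h
    · have : n * (j₀ + 1) ≤ n * j := Int.mul_le_mul_of_nonneg_left (by omega) hn0.le
      rw [mul_add] at this
      omega
  have hmem : k + -(n * j₀) ∈ Finset.Icc (-(m : ℤ)) m := by
    rw [Finset.mem_Icc]
    omega
  rw [Finset.sum_eq_single_of_mem (k + -(n * j₀)) hmem, if_pos ⟨-j₀, by ring⟩]
  · refine hasSum_single j₀ fun j hj => coeffV_eq_zero hθ hm g fun h => hj (huniq j h)
  · intro i hi hne
    rw [if_neg]
    rintro ⟨r, hr⟩
    have hi' : i = k + -(n * -r) := by linarith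
    rw [hi'] at hi hne
    exact hne (by rw [huniq _ hi])

/-- With `k' = k - (2m+1)j` the factor `β(k)` reads `β(k' + (2m+1)j)`, so each aliasing term is a
multiplier in `k'` followed by a frequency shift. At `j = 0` the identity `β G = lam` merges the
main term with `f`. -/
lemma sub_opQ_eq_tsum {θ lam β : ℝ → ℝ} (hθ : IsCutoff θ) (hβ_ne : ∀ x, β x ≠ 0) {m : ℕ}
    (hm : 1 ≤ m) {g : Torus → ℂ} (hg : Integrable g torusMeasure) (k : ℤ) :
    (conv (phi lam) (fourierCoeff g) - opQ θ lam β m g) k =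
      ∑' j : ℤ, errorCoeff θ lam β m j (k + -((2 * m + 1) * j)) *
        fourierCoeff g (k + -((2 * m + 1) * j)) := by
  have hs := (hasSum_ite_eq (0 : ℤ) ((lam k : ℂ) * fourierCoeff g k)).sub
    ((hasSum_coeffV (lam := lam) (β := β) hθ hm g k).mul_left (β k : ℂ))
  rw [Pi.sub_apply, opQ_apply m hg]
  refine (hs.congr_fun fun j => ?_).tsum_eq.symm
  have hb : (β k : ℂ) ≠ 0 := by exact_mod_cast hβ_ne k
  by_cases hj : j = 0
  · subst hj
    simp only [errorCoeff, if_true, mul_zero, neg_zero, add_zero, coeffV, quot]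
    push_cast
    field_simp
  · simp only [errorCoeff, hj, if_false, coeffV]
    push_cast
    rw [show (k : ℝ) + -((2 * (m : ℝ) + 1) * j) + (2 * m + 1) * j = k by ring]
    ring

lemma seriesNorm_zero (p : ℝ≥0∞) : seriesNorm p 0 = 0 := by
  refine le_antisymm ((iInf₂_le (fun _ => 0) ⟨MemLp.zero', fun k => ?_⟩).trans ?_) zero_le
  · simp
  · simp [fourierCoeff]

end TranslateApprox

theorem mainTheorem1 (p : ℝ≥0∞) (hp : 1 ≤ p) (θ lam β : ℝ → ℝ)
    (hθ : TranslateApprox.IsCutoff θ)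
    (hlam_ne : ∀ x, lam x ≠ 0) (hβ_ne : ∀ x, β x ≠ 0)
    (hlam_bdd : ∃ C : ℝ, ∀ x, |lam x| ≤ C) (hβ_bdd : ∃ C : ℝ, ∀ x, |β x| ≤ C)
    (hlam : TranslateApprox.IsMonotoneType lam) (hβ : TranslateApprox.IsMonotoneType β) :
    ∃ c : ℝ, 0 < c ∧ ∀ (f : TranslateApprox.FormalSeries) (g : TranslateApprox.Torus → ℂ),
      TranslateApprox.Represents lam p f g → ∀ m : ℕ, 1 ≤ m →
        TranslateApprox.seriesNorm p (f - TranslateApprox.opQ θ lam β m g) ≤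
          ENNReal.ofReal c * TranslateApprox.epsilon lam β m *
            eLpNorm g p TranslateApprox.torusMeasure := by
  open TranslateApprox in
  obtain ⟨C, hC, hbound⟩ :=
    exists_tsum_coeffNorm_errorCoeff_le hθ hlam_ne hβ_ne hlam hβ.contDiff
  -- The added `1` keeps the constant positive even if `C = 0`, which the case of infinite `epsilon`
  -- needs.
  have hc0 : 0 < 2 * C.toReal + 1 := by positivity
  have hCc : 2 * C ≤ ENNReal.ofReal (2 * C.toReal + 1) := by
    rw [ENNReal.ofReal_add (by positivity) zero_le_one, ENNReal.ofReal_mul zero_le_two,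
      ENNReal.ofReal_toReal hC]
    simp
  refine ⟨2 * C.toReal + 1, hc0, ?_⟩
  rintro f g ⟨hg, rfl⟩ m hm
  have hgi : Integrable g torusMeasure := hg.integrable hp
  have he := sub_opQ_eq_tsum (lam := lam) hθ hβ_ne hm hgi
  -- If `epsilon` is infinite the right side is `∞` unless `‖g‖_p = 0`. In that case it is `∞ · 0 =
  -- 0`, but the error vanishes as well.
  rcases eq_or_ne (epsilon lam β m) ∞ with hε | hε
  · rcases eq_or_ne (eLpNorm g p torusMeasure) 0 with hg0 | hg0
    · have hae := (eLpNorm_eq_zero_iff hg.1 (one_pos.trans_le hp).ne').1 hg0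
      have hcoeff : ∀ k, fourierCoeff g k = 0 := fun k => by
        rw [fourierCoeff_congr_ae hae]
        simp [fourierCoeff]
      have hzero : conv (phi lam) (fourierCoeff g) - opQ θ lam β m g = 0 := by
        funext k
        rw [he]
        simp [hcoeff]
      rw [hzero, seriesNorm_zero]
      exact zero_le
    · rw [hε, ENNReal.mul_top (ENNReal.ofReal_pos.2 hc0).ne', ENNReal.top_mul hg0]
      exact le_top
  · have hfin : ∑' j, coeffNorm m (errorCoeff θ lam β m j) ≠ ∞ :=
      ((hbound m hm).trans_lt (by finiteness)).ne
    refine (seriesNorm_le_tsum_coeffNorm hp hm (fun j => -((2 * m + 1) * j)) hfin hg he).trans ?_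
    refine mul_le_mul' ?_ le_rfl
    calc _ ≤ 2 * (C * epsilon lam β m) := mul_le_mul' le_rfl (hbound m hm)
      _ ≤ _ := by
        rw [← mul_assoc]
        exact mul_le_mul' hCc le_rfl
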